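/- Graphs are finite and simple. A fixed-edge-free involution of a graph $G$ is an automorphism $\varphi$ of $G$ of order exactly $2$ such that $\{\varphi(u),\varphi(v)\}\neq\{u,v\}$ for every edge $\{u,v\}$ of $G$. Permuted Automorphism Reconstruction (PAR) is the following search problem. Input: two isomorphic graphs $G$ and $H$ and a fixed-edge-free involution $\beta$ of $H$. Find: a fixed-edge-free involution $\alpha$ of $G$. Graph Isomorphism (GI) is the following decision problem. Input: two graphs $G_0$ and $G_1$. Decide whether $G_0$ and $G_1$ are isomorphic. A problem $P$ is polynomial-time Turing reducible to a problem $Q$ if there are an oracle algorithm $M$ and a polynomial $p$ such that, for every oracle that returns a correct answer on each input of $Q$ (and is arbitrary on all other strings), $M$ with this oracle returns, on every input $x$ of $P$, a correct answer within $p(|x|)$ steps. Here graphs are given by adjacency matrices and permutations by permutation matrices. Theorem. PAR and GI are polynomial-time equivalent: PAR is polynomial-time Turing reducible to GI, and GI is polynomial-time Turing reducible to PAR. -/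

import Mathlib

/-! ### Oracle random access machines

Structured programs for a random access machine with addition and truncated subtraction, finitely
many registers and finitely many arrays, and access to a string oracle. Every elementary
instruction and every test costs one step; an oracle call also costs one step for each symbol of
the query, and the answer is then available at once. (No multiplication or shift is
available, so a number produced within `t` steps has `O(t)` bits more than the constants of the
program, and the unit cost measure is polynomially related to Turing machine time.) -/

namespace OracleRAM

/-- Programs. Registers and arrays are named by natural numbers; constants are fixed in the text
of the program. -/
inductive Prog : Type
  /-- `reg r := k` -/
  | const (r k : ℕ)
  /-- `reg r := reg a + reg b` -/
  | add (r a b : ℕ)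
  /-- `reg r := reg a - reg b`, truncated at `0` -/
  | sub (r a b : ℕ)
  /-- `reg r := A[reg i]` -/
  | load (r A i : ℕ)
  /-- `A[reg i] := reg r` -/
  | store (A i r : ℕ)
  /-- call the oracle on the string written in array `Q`; the answer is written into array `A` -/
  | query (Q A : ℕ)
  /-- sequential composition -/
  | seq (c d : Prog)
  /-- run `c` if `reg r ≠ 0`, and `d` otherwise -/
  | ite (r : ℕ) (c d : Prog)
  /-- as long as `reg r ≠ 0`, run `c` -/
  | loop (r : ℕ) (c : Prog)

/-- Contents of the registers, and of the arrays: `mem A i` is the cell `A[i]`. -/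
@[ext]
structure State : Type where
  reg : ℕ → ℕ
  mem : ℕ → ℕ → ℕ

namespace State

def setReg (s : State) (r v : ℕ) : State :=
  { s with reg := Function.update s.reg r v }

def setArray (s : State) (A : ℕ) (f : ℕ → ℕ) : State :=
  { s with mem := Function.update s.mem A f }

def setCell (s : State) (A i v : ℕ) : State :=
  s.setArray A (Function.update (s.mem A) i v)

end State

/-- A bit string as the contents of an array: `1` stands for the bit `false`, `2` for the bit
`true`, and all cells behind the end of the string are blank, that is, `0`. -/
def cells (w : List Bool) (i : ℕ) : ℕ :=
  match w[i]? with
  | none => 0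
  | some false => 1
  | some true => 2

/-- The string `w` is written in the array `f`, from cell `0` up to the first blank. -/
def Holds (f : ℕ → ℕ) (w : List Bool) : Prop :=
  ∀ i ≤ w.length, f i = cells w i

/-- `Exec O c s s' t`: with oracle `O`, the program `c` started in state `s` halts after exactly
`t` steps, in state `s'`. -/
inductive Exec (O : List Bool → List Bool) : Prog → State → State → ℕ → Prop
  | const (s : State) (r k : ℕ) : Exec O (.const r k) s (s.setReg r k) 1
  | add (s : State) (r a b : ℕ) : Exec O (.add r a b) s (s.setReg r (s.reg a + s.reg b)) 1
  | sub (s : State) (r a b : ℕ) : Exec O (.sub r a b) s (s.setReg r (s.reg a - s.reg b)) 1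
  | load (s : State) (r A i : ℕ) : Exec O (.load r A i) s (s.setReg r (s.mem A (s.reg i))) 1
  | store (s : State) (A i r : ℕ) : Exec O (.store A i r) s (s.setCell A (s.reg i) (s.reg r)) 1
  | query (s : State) (Q A : ℕ) (w : List Bool) (hw : Holds (s.mem Q) w) :
      Exec O (.query Q A) s (s.setArray A (cells (O w))) (w.length + 1)
  | seq {c d : Prog} {s s' s'' : State} {t t' : ℕ} (hc : Exec O c s s' t)
      (hd : Exec O d s' s'' t') : Exec O (.seq c d) s s'' (t + t')
  | ite_true {r : ℕ} {c d : Prog} {s s' : State} {t : ℕ} (hr : s.reg r ≠ 0)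
      (hc : Exec O c s s' t) : Exec O (.ite r c d) s s' (t + 1)
  | ite_false {r : ℕ} {c d : Prog} {s s' : State} {t : ℕ} (hr : s.reg r = 0)
      (hd : Exec O d s s' t) : Exec O (.ite r c d) s s' (t + 1)
  | loop_true {r : ℕ} {c : Prog} {s s' s'' : State} {t t' : ℕ} (hr : s.reg r ≠ 0)
      (hc : Exec O c s s' t) (hw : Exec O (.loop r c) s' s'' t') :
      Exec O (.loop r c) s s'' (t + t' + 1)
  | loop_false {r : ℕ} {c : Prog} {s : State} (hr : s.reg r = 0) :
      Exec O (.loop r c) s s 1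

/-- The initial state on input `x`: the input is written in array `0`; all else is `0`. -/
def initState (x : List Bool) : State :=
  State.setArray ⟨fun _ => 0, fun _ _ => 0⟩ 0 (cells x)

/-- With oracle `O`, the program `c` on input `x` halts within `T` steps with the string `y`
written in the output array `1`. -/
def Outputs (O : List Bool → List Bool) (c : Prog) (x y : List Bool) (T : ℕ) : Prop :=
  ∃ s t, Exec O c (initState x) s t ∧ t ≤ T ∧ Holds (s.mem 1) y

end OracleRAM

/-! ### Search problems and polynomial-time Turing reductions -/

/-- A search problem: instances, their encoding by bit strings, and the set of strings that are
correct answers to an instance. (A decision problem is the special case in which the one correct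
answer is the truth value.) -/
structure SearchProblem : Type 1 where
  Inst : Type
  encode : Inst → List Bool
  encode_injective : Function.Injective encode
  IsAnswer : Inst → List Bool → Prop

/-- The oracle `O` solves `P`: it answers every instance correctly. Nothing is assumed about its
answers to strings that do not encode an instance. -/
def SearchProblem.SolvedBy (P : SearchProblem) (O : List Bool → List Bool) : Prop :=
  ∀ I : P.Inst, P.IsAnswer I (O (P.encode I))

/-- Polynomial-time Turing reducibility: one program solves `P` in polynomial time, whatever the
oracle solving `Q` that it is given. -/
def PolyTimeTuringReducible (P Q : SearchProblem) : Prop :=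
  ∃ (c : OracleRAM.Prog) (p : Polynomial ℕ), ∀ O : List Bool → List Bool, Q.SolvedBy O →
    ∀ I : P.Inst, ∃ y : List Bool, P.IsAnswer I y ∧
      OracleRAM.Outputs O c (P.encode I) y (p.eval (P.encode I).length)

def PolyTimeEquivalent (P Q : SearchProblem) : Prop :=
  PolyTimeTuringReducible P Q ∧ PolyTimeTuringReducible Q P

/-! ### Encodings of graphs and permutations -/

open Classical in
/-- The `n × n` matrix of a binary relation, row by row. -/
noncomputable def matrixBits {n : ℕ} (r : Fin n → Fin n → Prop) : List Bool :=
  List.ofFn fun k : Fin (n * n) => decide (r k.divNat k.modNat)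

/-- A graph is encoded by its number of vertices in unary, a separator and its adjacency matrix. -/
noncomputable def graphCode {n : ℕ} (G : SimpleGraph (Fin n)) : List Bool :=
  List.replicate n true ++ false :: matrixBits G.Adj

/-- A permutation is encoded by its permutation matrix. -/
noncomputable def permCode {n : ℕ} (α : Equiv.Perm (Fin n)) : List Bool :=
  matrixBits fun i j => α i = j

theorem matrixBits_injective {n : ℕ} : Function.Injective (@matrixBits n) := by
  intro r r' h
  have h' := List.ofFn_injective h
  funext i j
  have h2 := congrFun h' (finProdFinEquiv (i, j))
  have h3 : (finProdFinEquiv (i, j)).divNat = i ∧ (finProdFinEquiv (i, j)).modNat = j := by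
    have := finProdFinEquiv.symm_apply_apply (i, j)
    exact ⟨congrArg Prod.fst this, congrArg Prod.snd this⟩
  rw [h3.1, h3.2] at h2
  simpa using h2

theorem unary_append_injective {n m : ℕ} {s t : List Bool}
    (h : List.replicate n true ++ false :: s = List.replicate m true ++ false :: t) :
    n = m ∧ s = t := by
  induction n generalizing m with
  | zero => cases m <;> simp_all [List.replicate_succ]
  | succ n ih =>
    cases m with
    | zero => simp [List.replicate_succ] at h
    | succ m =>
      simp only [List.replicate_succ, List.cons_append, List.cons.injEq, true_and] at h
      obtain ⟨h1, h2⟩ := ih h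
      exact ⟨by rw [h1], h2⟩

theorem graphCode_append_injective {n m : ℕ} {G : SimpleGraph (Fin n)} {H : SimpleGraph (Fin m)}
    {s t : List Bool} (h : graphCode G ++ s = graphCode H ++ t) :
    n = m ∧ G ≍ H ∧ s = t := by
  unfold graphCode at h
  simp only [List.append_assoc, List.cons_append] at h
  obtain ⟨rfl, h⟩ := unary_append_injective h
  obtain ⟨h1, h2⟩ := List.append_inj h (by simp [matrixBits])
  refine ⟨rfl, heq_of_eq ?_, h2⟩
  exact SimpleGraph.ext (matrixBits_injective h1)

theorem permCode_injective {n : ℕ} : Function.Injective (@permCode n) := by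
  intro α β h
  have h' := matrixBits_injective h
  ext i
  have := congrFun (congrFun h' i) (α i)
  simp only [eq_iff_iff, true_iff] at this
  rw [this]

/-! ### The two problems -/

/-- `α` is a fixed-edge-free involutory automorphism of `G`: a permutation of order two of the
vertices which preserves adjacency and whose induced action on the edges has no fixed point. -/
def IsFixedEdgeFreeInvolution {n : ℕ} (G : SimpleGraph (Fin n)) (α : Equiv.Perm (Fin n)) : Prop :=
  (∀ u v, G.Adj (α u) (α v) ↔ G.Adj u v) ∧ orderOf α = 2 ∧ ∀ e ∈ G.edgeSet, Sym2.map α e ≠ e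

/-- A pair of arbitrary finite graphs. -/
structure GIInstance : Type where
  n₀ : ℕ
  n₁ : ℕ
  G₀ : SimpleGraph (Fin n₀)
  G₁ : SimpleGraph (Fin n₁)

noncomputable def GIInstance.encode (I : GIInstance) : List Bool :=
  graphCode I.G₀ ++ graphCode I.G₁

theorem GIInstance.encode_injective : Function.Injective GIInstance.encode := by
  rintro ⟨n₀, n₁, G₀, G₁⟩ ⟨m₀, m₁, H₀, H₁⟩ h
  obtain ⟨rfl, h0, h⟩ := graphCode_append_injective h
  obtain ⟨rfl, h1, -⟩ := graphCode_append_injective (s := []) (t := []) (by simpa using h)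
  cases h0
  cases h1
  rfl

open Classical in
/-- Graph Isomorphism: given two graphs, recognize whether they are isomorphic. -/
noncomputable def GI : SearchProblem where
  Inst := GIInstance
  encode := GIInstance.encode
  encode_injective := GIInstance.encode_injective
  IsAnswer I y := y = [decide (Nonempty (I.G₀ ≃g I.G₁))]

/-- Isomorphic graphs `G` and `H` (necessarily with the same number of vertices) together with a
fixed-edge-free involutory automorphism `β` of `H`. -/
structure PARInstance : Type where
  n : ℕ
  G : SimpleGraph (Fin n)
  H : SimpleGraph (Fin n)
  β : Equiv.Perm (Fin n)
  iso : Nonempty (G ≃g H)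
  involution : IsFixedEdgeFreeInvolution H β

noncomputable def PARInstance.encode (I : PARInstance) : List Bool :=
  graphCode I.G ++ (graphCode I.H ++ permCode I.β)

theorem PARInstance.encode_injective : Function.Injective PARInstance.encode := by
  rintro ⟨n, G, H, β, _, _⟩ ⟨n', G', H', β', _, _⟩ h
  obtain ⟨rfl, h0, h⟩ := graphCode_append_injective h
  obtain ⟨-, h1, h⟩ := graphCode_append_injective h
  cases h0
  cases h1
  cases permCode_injective h
  rfl

/-- Permuted Automorphism Reconstruction: find a fixed-edge-free involutory automorphism of `G`. -/
noncomputable def PAR : SearchProblem where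
  Inst := PARInstance
  encode := PARInstance.encode
  encode_injective := PARInstance.encode_injective
  IsAnswer I y := ∃ α : Equiv.Perm (Fin I.n), IsFixedEdgeFreeInvolution I.G α ∧ y = permCode α

/-!
GI reduces to PAR by doubling. Both halves of the disjoint union of the double cones over `X` and
`Y` contain two universal vertices, so an automorphism that maps no edge to itself must
exchange the halves, and such an involution exists if and only if `X` and `Y` are isomorphic. For
`Y = X` the exchange is known in advance, and serves as `β`. The answer of the oracle is checked,
since the instance is legitimate only if `X` and `Y` are isomorphic.

PAR reduces to GI by finding an isomorphism from `G` to `H` vertex by vertex, and conjugating `β`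
by it. The images already found are enforced by attaching different numbers of pendant vertices.
Two additional pendants at every vertex ensure that the pendants can be recognized by their degree.

Both algorithms are written in a language in which the number of rounds of each loop is bounded by
the length of the input, so that every program compiles to a polynomial-time oracle machine.
-/

/-! ### Graphs -/

/-- An involutory automorphism `f` of `G`, given as a function on the vertices, which maps no edge
to itself. If `G` has an edge then `f` is not the identity, so this is a fixed-edge-free
involution in the sense of `IsFixedEdgeFreeInvolution`, for vertices of any type. -/
structure IsEdgeDisplacing {V : Type*} (G : SimpleGraph V) (f : V → V) : Prop where
  involutive : Function.Involutive f
  adj_iff (u v : V) : G.Adj (f u) (f v) ↔ G.Adj u v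
  map_edge_ne {u v : V} (h : G.Adj u v) : s(f u, f v) ≠ s(u, v)

namespace IsEdgeDisplacing

variable {V W : Type*} {G : SimpleGraph V} {H : SimpleGraph W} {f : V → V}

theorem conj {g : W → W} (hg : IsEdgeDisplacing H g) (φ : G ≃g H) :
    IsEdgeDisplacing G (φ.symm ∘ g ∘ φ) where
  involutive v := by simp [hg.involutive (φ v)]
  adj_iff u v := by simp [φ.symm.map_adj_iff, hg.adj_iff, φ.map_adj_iff]
  map_edge_ne {u v} huv h := by
    refine hg.map_edge_ne (φ.map_adj_iff.2 huv) ?_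
    simpa using congrArg (Sym2.map φ) h

theorem not_adj_apply (hf : IsEdgeDisplacing G f) (v : V) : ¬G.Adj v (f v) := fun h =>
  hf.map_edge_ne h (by rw [hf.involutive v, Sym2.eq_swap])

theorem not_adj_of_fixed (hf : IsEdgeDisplacing G f) {u v : V} (hu : f u = u) (hv : f v = v) :
    ¬G.Adj u v := fun h => hf.map_edge_ne h (by rw [hu, hv])

end IsEdgeDisplacing

theorem isFixedEdgeFreeInvolution_iff {n : ℕ} {G : SimpleGraph (Fin n)}
    {α : Equiv.Perm (Fin n)} :
    IsFixedEdgeFreeInvolution G α ↔ α ≠ 1 ∧ IsEdgeDisplacing G α := by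
  unfold IsFixedEdgeFreeInvolution
  rw [orderOf_eq_prime_iff]
  constructor
  · rintro ⟨hadj, ⟨hsq, hne⟩, hedge⟩
    exact ⟨hne, fun v => DFunLike.congr_fun ((sq α).symm.trans hsq) v, hadj,
      fun {u v} h => hedge s(u, v) h⟩
  · rintro ⟨hne, hα⟩
    refine ⟨hα.adj_iff, ⟨Equiv.ext fun v => ?_, hne⟩, fun e => ?_⟩
    · exact hα.involutive v
    · induction e with
      | h u v => exact fun h => hα.map_edge_ne h

theorem IsFixedEdgeFreeInvolution.conj {n : ℕ} {G H : SimpleGraph (Fin n)}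
    {β : Equiv.Perm (Fin n)} (hβ : IsFixedEdgeFreeInvolution H β) (φ : G ≃g H) :
    IsFixedEdgeFreeInvolution G (φ.toEquiv.symm.permCongr β) := by
  rw [isFixedEdgeFreeInvolution_iff] at hβ ⊢
  refine ⟨fun h => hβ.1 ?_, hβ.2.conj φ⟩
  exact φ.toEquiv.symm.permCongrHom.map_eq_one_iff.1 h

section Sum

variable {V W : Type*} {G : SimpleGraph V} {H : SimpleGraph W}

theorem isEdgeDisplacing_sum_swap (G : SimpleGraph V) :
    IsEdgeDisplacing (G ⊕g G) Sum.swap where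
  involutive := Sum.swap_swap
  adj_iff := by rintro (u | u) (v | v) <;> simp
  map_edge_ne := by rintro (u | u) (v | v) <;> simp

theorem IsEdgeDisplacing.isRight_apply_inl {f : V ⊕ W → V ⊕ W}
    (hf : IsEdgeDisplacing (G ⊕g H) f) {u u' : V} (hne : u ≠ u')
    (hu : ∀ v, v ≠ u → G.Adj u v) (hu' : ∀ v, v ≠ u' → G.Adj u' v) (v : V) :
    (f (.inl v)).isRight := by
  have fixed {x y : V} (hx : ∀ v, v ≠ x → G.Adj x v) (h : f (.inl x) = .inl y) : y = x := by
    by_contra hyx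
    exact hf.not_adj_apply (.inl x) (by simpa [h] using hx y hyx)
  have adj {x y : V} (h : G.Adj x y) : (f (.inl x)).isLeft ↔ (f (.inl y)).isLeft := by
    have hxy := (hf.adj_iff (.inl x) (.inl y)).2 (SimpleGraph.sum_adj_inl.2 h)
    generalize f (.inl x) = a, f (.inl y) = b at hxy ⊢
    rcases a with a | a <;> rcases b with b | b <;> first | rfl | exact absurd hxy (by simp)
  have huu' : G.Adj u u' := hu u' hne.symm
  have hright : ¬(f (.inl u)).isLeft := by
    intro hleft
    obtain ⟨y, hy⟩ := Sum.isLeft_iff.1 hleft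
    obtain ⟨y', hy'⟩ := Sum.isLeft_iff.1 ((adj huu').1 hleft)
    obtain rfl := fixed hu hy
    obtain rfl := fixed hu' hy'
    exact hf.not_adj_of_fixed hy hy' (by simpa using huu')
  obtain rfl | hv := eq_or_ne v u
  · simpa using hright
  · simpa [adj (hu v hv)] using hright

theorem IsEdgeDisplacing.nonempty_iso_of_card_eq [Fintype V] [Fintype W]
    (hcard : Fintype.card V = Fintype.card W) {f : V ⊕ W → V ⊕ W}
    (hf : IsEdgeDisplacing (G ⊕g H) f) (hright : ∀ v, (f (.inl v)).isRight) :
    Nonempty (G ≃g H) := by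
  choose g hg using fun v => Sum.isRight_iff.1 (hright v)
  have hinj : Function.Injective g := fun u v h => by
    have := hf.involutive.injective ((hg u).trans ((congrArg Sum.inr h).trans (hg v).symm))
    exact Sum.inl_injective this
  refine ⟨⟨Equiv.ofBijective g ((Fintype.bijective_iff_injective_and_card g).2 ⟨hinj, hcard⟩),
    fun {u v} => ?_⟩⟩
  simpa [hg] using hf.adj_iff (.inl u) (.inl v)

end Sum

section Cone

variable {V W : Type*}

/-- The cone over `G`: the new vertex `none` is adjacent to all vertices of `G`. -/
def cone (G : SimpleGraph V) : SimpleGraph (Option V) :=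
  SimpleGraph.fromRel fun a b => a = none ∨ ∃ u v, a = some u ∧ b = some v ∧ G.Adj u v

variable {G : SimpleGraph V} {H : SimpleGraph W}

@[simp]
theorem cone_adj_some_some {u v : V} : (cone G).Adj (some u) (some v) ↔ G.Adj u v := by
  simpa [cone, G.adj_comm v u] using SimpleGraph.Adj.ne

@[simp]
theorem cone_adj_none_left {a : Option V} : (cone G).Adj none a ↔ a ≠ none := by
  simp [cone, eq_comm]

@[simp]
theorem cone_adj_none_right {a : Option V} : (cone G).Adj a none ↔ a ≠ none := by
  simp [cone]

/-- The isomorphism of cones induced by an isomorphism of graphs. -/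
def coneCongr (φ : G ≃g H) : cone G ≃g cone H where
  toEquiv := Equiv.optionCongr φ.toEquiv
  map_rel_iff' := by rintro (_ | u) (_ | v) <;> simp [φ.map_adj_iff]

/-- Any isomorphism can be corrected to one that matches the apices, as universal vertices are
interchangeable. -/
theorem nonempty_iso_of_cone_iso (φ : cone G ≃g cone H) : Nonempty (G ≃g H) := by
  have apply_removeNone (v : V) : some (φ.toEquiv.removeNone v) = φ (some v) ∨
      φ (some v) = none ∧ some (φ.toEquiv.removeNone v) = φ none := by
    cases h : φ (some v) with
    | none => exact .inr ⟨rfl, φ.toEquiv.removeNone_none h⟩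
    | some w => exact .inl ((φ.toEquiv.removeNone_some ⟨w, h⟩).trans h)
  refine ⟨⟨φ.toEquiv.removeNone, fun {u v} => ?_⟩⟩
  rw [← cone_adj_some_some (G := H), ← cone_adj_some_some (G := G), ← φ.map_adj_iff]
  rcases apply_removeNone u with hu | ⟨hu, hu'⟩ <;> rcases apply_removeNone v with hv | ⟨hv, hv'⟩
  · rw [hu, hv]
  · rw [hu, hv', φ.map_adj_iff, hv]
    simp [← hu]
  · rw [hu', hv, φ.map_adj_iff, hu]
    simp [← hv]
  · obtain rfl := Option.some_injective _ (φ.injective (hu.trans hv.symm))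
    simp

end Cone

section DoubledGraph

variable {V W : Type*} {X : SimpleGraph V} {Y : SimpleGraph W}

/-- The disjoint union of the double cones over `X` and `Y`. Its edge-displacing involutions
exchange the two halves, so that they exist exactly if `X` and `Y` are isomorphic. -/
def doubledGraph (X : SimpleGraph V) (Y : SimpleGraph W) :
    SimpleGraph (Option (Option V) ⊕ Option (Option W)) :=
  cone (cone X) ⊕g cone (cone Y)

/-- The isomorphism of doubled graphs induced by an isomorphism of the second components. -/
def doubledGraphCongrRight {V' : Type*} {Y' : SimpleGraph V'} (φ : Y ≃g Y') :
    doubledGraph X Y ≃g doubledGraph X Y' :=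
  SimpleGraph.Iso.refl.sumCongr (coneCongr (coneCongr φ))

theorem exists_isEdgeDisplacing_doubledGraph_iff [Fintype V] [Fintype W]
    (hcard : Fintype.card V = Fintype.card W) :
    (∃ f, IsEdgeDisplacing (doubledGraph X Y) f) ↔ Nonempty (X ≃g Y) := by
  constructor
  · rintro ⟨f, hf⟩
    have hright := hf.isRight_apply_inl (u := none) (u' := some none) (by simp)
      (by simp) (by rintro (_ | _ | v) <;> simp)
    obtain ⟨φ⟩ := hf.nonempty_iso_of_card_eq (by simp [hcard]) hright
    obtain ⟨φ⟩ := nonempty_iso_of_cone_iso φ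
    exact nonempty_iso_of_cone_iso φ
  · rintro ⟨φ⟩
    exact ⟨_, (isEdgeDisplacing_sum_swap _).conj (doubledGraphCongrRight φ.symm)⟩

end DoubledGraph

section PendantGraph

variable {V W : Type*} {m : ℕ}

/-- The ordered pairs that become edges of `pendantGraph`. -/
def IsPendantArc (G : SimpleGraph V) (c : V → ℕ) (p q : V × Fin (m + 1)) : Prop :=
  p.2 = 0 ∧ (q.2 = 0 ∧ G.Adj p.1 q.1 ∨ q.2 ≠ 0 ∧ (q.2 : ℕ) ≤ c p.1 ∧ p.1 = q.1)

/-- The graph `G` with `c v` pendant vertices attached to each vertex `v`. The vertex `v` of `G`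
becomes `(v, 0)`, and its pendant vertices are the `(v, i)` with `0 < i ≤ c v`; the
remaining `(v, i)` are isolated. -/
def pendantGraph (G : SimpleGraph V) (c : V → ℕ) (m : ℕ) : SimpleGraph (V × Fin (m + 1)) :=
  SimpleGraph.fromRel (IsPendantArc G c)

variable {G : SimpleGraph V} {H : SimpleGraph W} {c : V → ℕ} {d : W → ℕ}

@[simp]
theorem pendantGraph_adj_zero_zero {v w : V} :
    (pendantGraph G c m).Adj (v, 0) (w, 0) ↔ G.Adj v w := by
  simpa [pendantGraph, IsPendantArc, G.adj_comm w v] using SimpleGraph.Adj.ne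

theorem pendantGraph_adj_zero_left {v w : V} {i : Fin (m + 1)} (hi : i ≠ 0) :
    (pendantGraph G c m).Adj (v, 0) (w, i) ↔ (i : ℕ) ≤ c v ∧ v = w := by
  simp [pendantGraph, IsPendantArc, hi, hi.symm]

theorem pendantGraph_not_adj {v w : V} {i j : Fin (m + 1)} (hi : i ≠ 0) (hj : j ≠ 0) :
    ¬(pendantGraph G c m).Adj (v, i) (w, j) := by
  simp [pendantGraph, IsPendantArc, hi, hj]

theorem neighborSet_pendantGraph_subsingleton_iff (hc : ∀ v, 2 ≤ c v) (hcm : ∀ v, c v ≤ m)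
    (p : V × Fin (m + 1)) :
    ((pendantGraph G c m).neighborSet p).Subsingleton ↔ p.2 ≠ 0 := by
  obtain ⟨v, i⟩ := p
  constructor
  · rintro h rfl
    have hm : 2 ≤ m := (hc v).trans (hcm v)
    have mem (k : ℕ) (hk : 0 < k) (hkm : k < m + 1) (hkc : k ≤ c v) :
        (v, ⟨k, hkm⟩) ∈ (pendantGraph G c m).neighborSet (v, 0) :=
      (pendantGraph_adj_zero_left (by simpa [Fin.ext_iff] using hk.ne')).2 ⟨hkc, rfl⟩
    have h12 := h (mem 1 one_pos (by omega) (one_le_two.trans (hc v)))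
      (mem 2 two_pos (by omega) (hc v))
    simp at h12
  · have eq_main {q : V × Fin (m + 1)} (hi : i ≠ 0)
        (hq : (pendantGraph G c m).Adj (v, i) q) : q = (v, 0) := by
      obtain ⟨w, j⟩ := q
      obtain rfl : j = 0 := by_contra fun hj => pendantGraph_not_adj hi hj hq
      rw [((pendantGraph_adj_zero_left hi).1 hq.symm).2]
    exact fun hi q hq q' hq' => (eq_main hi hq).trans (eq_main hi hq').symm

theorem ncard_pendants (hcm : ∀ v, c v ≤ m) (v : V) :
    {q | (pendantGraph G c m).Adj (v, 0) q ∧ q.2 ≠ 0}.ncard = c v := by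
  have hpendants : {q | (pendantGraph G c m).Adj (v, 0) q ∧ q.2 ≠ 0} =
      (fun i => (v, i)) '' (Finset.Ioc 0 (⟨c v, Nat.lt_succ_of_le (hcm v)⟩ : Fin (m + 1))) := by
    ext ⟨w, i⟩
    by_cases hi : i = 0
    · simp [hi]
    · simp [pendantGraph_adj_zero_left hi, hi, Fin.pos_iff_ne_zero, Fin.le_def]
  rw [hpendants, Set.ncard_image_of_injective _ (Prod.mk_right_injective v),
    Set.ncard_coe_finset, Fin.card_Ioc]
  simp

theorem snd_pendantGraph_iso_apply_eq_zero_iff (hc : ∀ v, 2 ≤ c v) (hcm : ∀ v, c v ≤ m)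
    (hd : ∀ w, 2 ≤ d w) (hdm : ∀ w, d w ≤ m)
    (φ : pendantGraph G c m ≃g pendantGraph H d m) (p : V × Fin (m + 1)) :
    (φ p).2 = 0 ↔ p.2 = 0 := by
  rw [← not_iff_not, ← ne_eq, ← neighborSet_pendantGraph_subsingleton_iff hd hdm,
    ← φ.image_neighborSet, φ.injective.subsingleton_image_iff,
    neighborSet_pendantGraph_subsingleton_iff hc hcm]

theorem nonempty_pendantGraph_iso_iff (hc : ∀ v, 2 ≤ c v) (hcm : ∀ v, c v ≤ m)
    (hd : ∀ w, 2 ≤ d w) (hdm : ∀ w, d w ≤ m) :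
    Nonempty (pendantGraph G c m ≃g pendantGraph H d m) ↔ ∃ ψ : G ≃g H, ∀ v, d (ψ v) = c v := by
  constructor
  · rintro ⟨φ⟩
    have snd_eq_zero := snd_pendantGraph_iso_apply_eq_zero_iff hc hcm hd hdm φ
    have apply_main (v : V) : φ (v, 0) = ((φ (v, 0)).1, 0) :=
      Prod.ext rfl ((snd_eq_zero (v, 0)).2 rfl)
    have symm_apply_main (w : W) : φ.symm (w, 0) = ((φ.symm (w, 0)).1, 0) :=
      Prod.ext rfl ((snd_eq_zero _).1 (by rw [φ.apply_symm_apply]))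
    let ψ : G ≃g H :=
      { toFun v := (φ (v, 0)).1
        invFun w := (φ.symm (w, 0)).1
        left_inv v := by simp only [← apply_main, φ.symm_apply_apply]
        right_inv w := by simp only [← symm_apply_main, φ.apply_symm_apply]
        map_rel_iff' {u v} := by
          change H.Adj (φ (u, 0)).1 (φ (v, 0)).1 ↔ _
          rw [← pendantGraph_adj_zero_zero (c := d) (m := m), ← apply_main, ← apply_main,
            φ.map_adj_iff, pendantGraph_adj_zero_zero] }
    refine ⟨ψ, fun v => ?_⟩
    have himage : φ '' {q | (pendantGraph G c m).Adj (v, 0) q ∧ q.2 ≠ 0} =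
        {q | (pendantGraph H d m).Adj (ψ v, 0) q ∧ q.2 ≠ 0} := by
      rw [show (ψ v, 0) = φ (v, 0) from (apply_main v).symm, φ.image_eq_preimage_symm]
      ext q
      simp [← snd_eq_zero, ← φ.map_adj_iff]
    rw [← ncard_pendants (G := H) hdm, ← himage, Set.ncard_image_of_injective _ φ.injective,
      ncard_pendants hcm]
  · rintro ⟨ψ, hψ⟩
    refine ⟨⟨ψ.toEquiv.prodCongr (Equiv.refl _), fun {p q} => ?_⟩⟩
    simp [pendantGraph, IsPendantArc, hψ, ψ.map_adj_iff,
      (ψ.injective.prodMap Function.injective_id).ne_iff]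

theorem pendantGraph_comap_symm_adj {ι : Type*} (e : V × Fin (m + 1) ≃ ι) {i j : ι} :
    ((pendantGraph G c m).comap e.symm).Adj i j ↔
      i ≠ j ∧ ∃ v p w q, IsPendantArc G c (v, p) (w, q) ∧
        (i = e (v, p) ∧ j = e (w, q) ∨ i = e (w, q) ∧ j = e (v, p)) := by
  rw [SimpleGraph.comap_adj, pendantGraph, SimpleGraph.fromRel_adj, e.symm.injective.ne_iff]
  refine and_congr_right fun _ => ⟨?_, ?_⟩
  · rintro (h | h)
    · exact ⟨_, _, _, _, h, .inl ⟨(e.apply_symm_apply i).symm, (e.apply_symm_apply j).symm⟩⟩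
    · exact ⟨_, _, _, _, h, .inr ⟨(e.apply_symm_apply i).symm, (e.apply_symm_apply j).symm⟩⟩
  · rintro ⟨v, p, w, q, h, ⟨rfl, rfl⟩ | ⟨rfl, rfl⟩⟩ <;> simp [h]

end PendantGraph

namespace LoopProgram

open OracleRAM

/-- The registers available to programs. -/
inductive Reg : Type
  | order₀ | order₁ | matrix₀ | matrix₁ | matrix₂
  | stage | candidate | found | row | column | vertex | vertex' | part | part' | factor
  deriving DecidableEq, Encodable

/-- The arrays available to programs. -/
inductive Arr : Type
  | input | answer | labels
  deriving DecidableEq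

/-- The state of a program: a constant which bounds the number of rounds of each loop, the
registers, the arrays, and the string written so far for the next query or as the output. -/
@[ext]
structure Store : Type where
  bound : ℕ
  reg : Reg → ℕ
  mem : Arr → ℕ → ℕ
  buf : List Bool

namespace Store

def setReg (σ : Store) (r : Reg) (v : ℕ) : Store :=
  { σ with reg := Function.update σ.reg r v }

def setArray (σ : Store) (A : Arr) (f : ℕ → ℕ) : Store :=
  { σ with mem := Function.update σ.mem A f }

def append (σ : Store) (w : List Bool) : Store :=
  { σ with buf := σ.buf ++ w }

end Store

/-- Expressions with values in the natural numbers. The expression `sum r m e` is the sum of `e`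
over the values `0, 1, …, m - 1` of the register `r`, cut off at the bound of the store, so that
the time to evaluate an expression is polynomial in this bound. -/
inductive Expr : Type
  | const (k : ℕ)
  | var (r : Reg)
  | bound
  | add (a b : Expr)
  | sub (a b : Expr)
  | load (A : Arr) (i : Expr)
  | ite (c a b : Expr)
  | sum (r : Reg) (m e : Expr)

/-- The value of an expression. -/
def Expr.eval : Expr → Store → ℕ
  | const k, _ => k
  | var r, σ => σ.reg r
  | bound, σ => σ.bound
  | add a b, σ => a.eval σ + b.eval σ
  | sub a b, σ => a.eval σ - b.eval σ
  | load A i, σ => σ.mem A (i.eval σ)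
  | ite c a b, σ => if c.eval σ ≠ 0 then a.eval σ else b.eval σ
  | sum r m e, σ => ∑ v ∈ Finset.range (min (m.eval σ) σ.bound), e.eval (σ.setReg r v)

/-- Commands. The command `ask` puts the string written so far to the oracle, and `loop r m c`
runs `c` for the values `0, 1, …, m - 1` of the register `r`, cut off at the bound of
the store, and then restores `r`. -/
inductive Cmd : Type
  | set (r : Reg) (e : Expr)
  | store (A : Arr) (i e : Expr)
  | push (e : Expr)
  | ask
  | seq (c d : Cmd)
  | loop (r : Reg) (m : Expr) (c : Cmd)

/-- The effect of `loop r m c` when `m` has the value `k` and `f` is the effect of `c`. -/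
def loopRun (r : Reg) (f : Store → Store) (k : ℕ) (σ : Store) : Store :=
  ((List.range k).foldl (fun σ v => f (σ.setReg r v)) σ).setReg r (σ.reg r)

/-- The effect of a command on the store, for the oracle `O`. -/
def Cmd.run (O : List Bool → List Bool) : Cmd → Store → Store
  | set r e, σ => σ.setReg r (e.eval σ)
  | store A i e, σ => σ.setArray A (Function.update (σ.mem A) (i.eval σ) (e.eval σ))
  | push e, σ => σ.append [decide (e.eval σ ≠ 0)]
  | ask, σ => { σ.setArray .answer (cells (O σ.buf)) with buf := [] }
  | seq c d, σ => d.run O (c.run O σ)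
  | loop r m c, σ => loopRun r (c.run O) (min (m.eval σ) σ.bound) σ

/-! ### Compilation -/

/-- The registers of the machine: the bound of the store, the length of the string written so far,
two constants, the registers of the program, and temporary registers. -/
inductive Loc : Type
  | bound | length | one | zero
  | reg (r : Reg)
  | tmp (t : ℕ)
  deriving DecidableEq, Encodable

/-- The number of a register of the machine. -/
abbrev Loc.num (l : Loc) : ℕ := Encodable.encode l

/-- The machine array in which the string for the next query or the output is written. -/
abbrev bufNum : ℕ := 1

/-- The number of an array; the numbers of the input and the output array are prescribed. -/
def Arr.num : Arr → ℕ
  | input => 0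
  | answer => 2
  | labels => 3

/-- A store together with the contents of the temporary registers. -/
@[ext]
structure Config extends Store where
  tmp : ℕ → ℕ

namespace Config

/-- The contents of the registers of the machine. -/
def get (κ : Config) : Loc → ℕ
  | .bound => κ.bound
  | .length => κ.buf.length
  | .one => 1
  | .zero => 0
  | .reg r => κ.reg r
  | .tmp t => κ.tmp t

def setReg (κ : Config) (r : Reg) (v : ℕ) : Config :=
  { κ with toStore := κ.toStore.setReg r v }

def setTmp (κ : Config) (t v : ℕ) : Config :=
  { κ with tmp := Function.update κ.tmp t v }

/-- The state `s` of the machine represents the configuration `κ`. -/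
structure RepresentedBy (κ : Config) (s : State) : Prop where
  reg_num (l : Loc) : s.reg l.num = κ.get l
  mem_num (A : Arr) : s.mem A.num = κ.mem A
  mem_buf {i : ℕ} (hi : i < κ.buf.length) : s.mem bufNum i = cells κ.buf i

end Config

/-- Started in a state that represents `κ`, the program `c` halts in a state that represents some
`κ'` with `Q κ'`. The time is at most `T`, up to the change in length of the string written so
far: a query is paid for when its symbols are written. -/
def Runs (O : List Bool → List Bool) (c : Prog) (κ : Config) (T : ℕ) (Q : Config → Prop) : Prop :=
  ∀ s, κ.RepresentedBy s → ∃ s' κ' t, Exec O c s s' t ∧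
    t + κ'.buf.length ≤ T + κ.buf.length ∧ κ'.RepresentedBy s' ∧ Q κ'

namespace Runs

variable {O : List Bool → List Bool} {c d : Prog} {κ κ' : Config} {T T' : ℕ}
  {P Q : Config → Prop}

theorem mono (h : Runs O c κ T P) (hT : T ≤ T') (hPQ : ∀ κ', P κ' → Q κ') :
    Runs O c κ T' Q := fun s hs =>
  let ⟨s', κ', t, hexec, ht, hs', hP⟩ := h s hs
  ⟨s', κ', t, hexec, by omega, hs', hPQ κ' hP⟩

theorem seq (hc : Runs O c κ T P) (hd : ∀ κ', P κ' → Runs O d κ' T' Q) :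
    Runs O (.seq c d) κ (T + T') Q := fun s hs =>
  let ⟨s', κ', _, hexec, _, hs', hP⟩ := hc s hs
  let ⟨s'', κ'', _, hexec', _, hs'', hQ⟩ := hd κ' hP s' hs'
  ⟨s'', κ'', _, hexec.seq hexec', by omega, hs'', hQ⟩

theorem ite {l : Loc} (hc : κ.get l ≠ 0 → Runs O c κ T Q) (hd : κ.get l = 0 → Runs O d κ T Q) :
    Runs O (.ite l.num c d) κ (T + 1) Q := fun s hs => by
  by_cases hl : κ.get l = 0
  · obtain ⟨s', κ', t, hexec, ht, hs', hQ⟩ := hd hl s hs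
    exact ⟨s', κ', _, hexec.ite_false (by rw [hs.reg_num, hl]), by omega, hs', hQ⟩
  · obtain ⟨s', κ', t, hexec, ht, hs', hQ⟩ := hc hl s hs
    exact ⟨s', κ', _, hexec.ite_true (by rwa [hs.reg_num]), by omega, hs', hQ⟩

theorem loop {l : Loc} {k : ℕ} {I : ℕ → Config → Prop} (h₀ : I 0 κ)
    (hI : ∀ v κ, I v κ → (κ.get l = 0 ↔ k ≤ v))
    (hc : ∀ v < k, ∀ κ, I v κ → Runs O c κ T (I (v + 1))) :
    Runs O (.loop l.num c) κ (k * (T + 1) + 1) (I k) := by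
  suffices ∀ j v κ, v + j = k → I v κ → Runs O (.loop l.num c) κ (j * (T + 1) + 1) (I k) from
    this k 0 κ (zero_add k) h₀
  intro j
  induction j with
  | zero =>
    rintro v κ rfl hv s hs
    have hzero : s.reg l.num = 0 := by rw [hs.reg_num, hI _ _ hv, add_zero]
    exact ⟨s, κ, _, .loop_false hzero, by omega, hs, hv⟩
  | succ j ih =>
    rintro v κ rfl hv s hs
    obtain ⟨s', κ', t, hexec, ht, hs', hv'⟩ := hc v (by omega) κ hv s hs
    obtain ⟨s'', κ'', t', hexec', ht', hs'', hk⟩ := ih (v + 1) κ' (by omega) hv' s' hs'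
    have hne : s.reg l.num ≠ 0 := by rw [hs.reg_num, Ne, hI _ _ hv]; omega
    refine ⟨s'', κ'', _, .loop_true hne hexec hexec', ?_, hs'', hk⟩
    linarith

end Runs

/-! ### Instructions -/

namespace Config

/-- `κ'` arises from `κ` by writing `v` into the register `l` of the machine. -/
structure IsUpdate (κ : Config) (l : Loc) (v : ℕ) (κ' : Config) : Prop where
  get_eq : κ'.get = Function.update κ.get l v
  mem_eq : κ'.mem = κ.mem
  buf_eq : κ'.buf = κ.buf

theorem isUpdate_setTmp (κ : Config) (t v : ℕ) : κ.IsUpdate (.tmp t) v (κ.setTmp t v) where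
  get_eq := by
    funext l
    cases l <;> simp [get, setTmp, Function.update_apply]
  mem_eq := rfl
  buf_eq := rfl

theorem isUpdate_setReg (κ : Config) (r : Reg) (v : ℕ) :
    κ.IsUpdate (.reg r) v (κ.setReg r v) where
  get_eq := by
    funext l
    cases l <;> simp [get, setReg, Store.setReg, Function.update_apply]
  mem_eq := rfl
  buf_eq := rfl

theorem IsUpdate.representedBy {κ κ' : Config} {l : Loc} {v : ℕ} (h : κ.IsUpdate l v κ')
    {s : State} (hs : κ.RepresentedBy s) : κ'.RepresentedBy (s.setReg l.num v) where
  reg_num l' := by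
    simp only [State.setReg, h.get_eq, Function.update_apply, hs.reg_num,
      Encodable.encode_injective.eq_iff]
  mem_num A := by rw [h.mem_eq, ← hs.mem_num A, State.setReg]
  mem_buf hi := by
    rw [h.buf_eq] at hi ⊢
    exact hs.mem_buf hi

end Config

namespace Runs

variable {O : List Bool → List Bool} {c d : Prog} {κ κ' : Config} {T T' : ℕ}
  {Q : Config → Prop}

theorem seq_eq (hc : Runs O c κ T (· = κ')) (hd : Runs O d κ' T' Q) :
    Runs O (.seq c d) κ (T + T') Q :=
  hc.seq fun _ h => h ▸ hd

theorem of_exec_setReg {l : Loc} {v : ℕ} (h : κ.IsUpdate l v κ')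
    (hexec : ∀ s, κ.RepresentedBy s → Exec O c s (s.setReg l.num v) 1) :
    Runs O c κ 1 (· = κ') := fun s hs =>
  ⟨_, κ', 1, hexec s hs, by rw [h.buf_eq], h.representedBy hs, rfl⟩

theorem const {l : Loc} {k : ℕ} (h : κ.IsUpdate l k κ') :
    Runs O (.const l.num k) κ 1 (· = κ') :=
  .of_exec_setReg h fun s _ => .const s _ _

theorem add {l a b : Loc} (h : κ.IsUpdate l (κ.get a + κ.get b) κ') :
    Runs O (.add l.num a.num b.num) κ 1 (· = κ') :=
  .of_exec_setReg h fun s hs => by simpa only [hs.reg_num] using Exec.add s l.num a.num b.num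

theorem sub {l a b : Loc} (h : κ.IsUpdate l (κ.get a - κ.get b) κ') :
    Runs O (.sub l.num a.num b.num) κ 1 (· = κ') :=
  .of_exec_setReg h fun s hs => by simpa only [hs.reg_num] using Exec.sub s l.num a.num b.num

theorem load {l i : Loc} {A : Arr} (h : κ.IsUpdate l (κ.mem A (κ.get i)) κ') :
    Runs O (.load l.num A.num i.num) κ 1 (· = κ') :=
  .of_exec_setReg h fun s hs => by
    simpa only [hs.reg_num, hs.mem_num] using Exec.load s l.num A.num i.num

end Runs

theorem Arr.num_injective : Function.Injective Arr.num := by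
  rintro (_ | _ | _) (_ | _ | _) <;> simp [Arr.num]

theorem Arr.num_ne_bufNum (A : Arr) : A.num ≠ bufNum := by
  cases A <;> simp [Arr.num]

namespace Config

def setArray (κ : Config) (A : Arr) (f : ℕ → ℕ) : Config :=
  { κ with toStore := κ.toStore.setArray A f }

theorem RepresentedBy.setArray {κ : Config} {s : State} (hs : κ.RepresentedBy s) (A : Arr)
    (f : ℕ → ℕ) : (κ.setArray A f).RepresentedBy (s.setArray A.num f) where
  reg_num := hs.reg_num
  mem_num A' := by
    simp only [State.setArray, Config.setArray, Store.setArray, Function.update_apply,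
      Arr.num_injective.eq_iff, hs.mem_num]
  mem_buf hi := by
    simp only [State.setArray, Function.update_of_ne A.num_ne_bufNum.symm]
    exact hs.mem_buf hi

end Config

theorem Runs.store {O : List Bool → List Bool} {κ : Config} {A : Arr} {i a : Loc} :
    Runs O (.store A.num i.num a.num) κ 1
      (· = κ.setArray A (Function.update (κ.mem A) (κ.get i) (κ.get a))) := by
  intro s hs
  refine ⟨_, _, 1, .store s _ _ _, ?_, ?_, rfl⟩
  · rfl
  · simpa only [State.setCell, hs.reg_num, hs.mem_num] using hs.setArray A _

/-! ### Expressions -/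

/-- The code which runs `body` with the register `r` set to `0, 1, …, m - 1`, where `m` is the value
of the temporary register `t + 1`, cut off at the bound, and then restores `r`. The temporary
register `t + 1` counts down, `t + 2` counts up, `t + 3` saves `r`, and `t` is left to `body`. -/
def forLoop (r : Reg) (t : ℕ) (body : Prog) : Prog :=
  .seq (.sub (Loc.tmp (t + 2)).num (Loc.tmp (t + 1)).num Loc.bound.num) <|
  .seq (.sub (Loc.tmp (t + 1)).num (Loc.tmp (t + 1)).num (Loc.tmp (t + 2)).num) <|
  .seq (.const (Loc.tmp (t + 2)).num 0) <|
  .seq (.add (Loc.tmp (t + 3)).num (Loc.reg r).num Loc.zero.num) <|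
  .seq (.loop (Loc.tmp (t + 1)).num <|
    .seq (.add (Loc.reg r).num (Loc.tmp (t + 2)).num Loc.zero.num) <|
    .seq body <|
    .seq (.add (Loc.tmp (t + 2)).num (Loc.tmp (t + 2)).num Loc.one.num) <|
    .sub (Loc.tmp (t + 1)).num (Loc.tmp (t + 1)).num Loc.one.num) <|
  .add (Loc.reg r).num (Loc.tmp (t + 3)).num Loc.zero.num

section ForLoop

open Config

variable {O : List Bool → List Bool} {r : Reg} {t k T : ℕ} {κ : Config} {body : Prog}
  {I : ℕ → Store → ℕ → Prop}

/-- The invariant of `forLoop`, with `I` for the store and the temporary register `t`. -/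
structure ForLoopInvariant (I : ℕ → Store → ℕ → Prop) (r : Reg) (t k : ℕ) (κ : Config) (v : ℕ)
    (κ' : Config) : Prop where
  inv : I v κ'.toStore (κ'.tmp t)
  remaining : κ'.tmp (t + 1) = k - v
  index : κ'.tmp (t + 2) = v
  saved : κ'.tmp (t + 3) = κ.reg r
  tmp_eq {u : ℕ} (hu : u < t) : κ'.tmp u = κ.tmp u

theorem Runs.forLoop_body {v : ℕ} {κ' : Config}
    (hκ' : ForLoopInvariant I r t k κ v κ')
    (hbody : ∀ κ' : Config, I v κ'.toStore (κ'.tmp t) →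
      Runs O body (κ'.setReg r v) T fun κ'' => I (v + 1) κ''.toStore (κ''.tmp t) ∧
        ∀ u < t + 4, u ≠ t → κ''.tmp u = κ'.tmp u) :
    Runs O (.seq (.add (Loc.reg r).num (Loc.tmp (t + 2)).num Loc.zero.num) <|
      .seq body <|
      .seq (.add (Loc.tmp (t + 2)).num (Loc.tmp (t + 2)).num Loc.one.num) <|
      .sub (Loc.tmp (t + 1)).num (Loc.tmp (t + 1)).num Loc.one.num) κ' (T + 3)
      (ForLoopInvariant I r t k κ (v + 1)) := by
  have hset : κ'.IsUpdate (.reg r) (κ'.get (.tmp (t + 2)) + κ'.get .zero) (κ'.setReg r v) := by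
    simpa [Config.get, hκ'.index] using κ'.isUpdate_setReg r v
  refine (Runs.seq_eq (.add hset) <| (hbody κ' hκ'.inv).seq fun κ₁ ⟨hinv, htmp⟩ =>
    Runs.seq_eq (.add (isUpdate_setTmp _ _ _)) <|
      (Runs.sub (isUpdate_setTmp _ _ _)).mono le_rfl ?_).mono (le_of_eq (by ring)) fun _ h => h
  rintro _ rfl
  constructor
  · simpa [setTmp] using hinv
  · simp [setTmp, Config.get, htmp, hκ'.remaining, Nat.sub_sub]
  · simp [setTmp, Config.get, htmp, hκ'.index]
  · simp [setTmp, Config.get, htmp, hκ'.saved]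
  · intro u hu
    have : u ≠ t + 1 ∧ u ≠ t + 2 := by omega
    simp [setTmp, this, htmp u (by omega) (by omega), hκ'.tmp_eq hu]

theorem Runs.forLoop {m : ℕ} (hm : κ.tmp (t + 1) = m)
    (h₀ : I 0 κ.toStore (κ.tmp t))
    (hbody : ∀ v, ∀ κ' : Config, I v κ'.toStore (κ'.tmp t) →
      Runs O body (κ'.setReg r v) T fun κ'' => I (v + 1) κ''.toStore (κ''.tmp t) ∧
        ∀ u < t + 4, u ≠ t → κ''.tmp u = κ'.tmp u) :
    Runs O (forLoop r t body) κ (κ.bound * (T + 4) + 6) fun κ' =>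
      (∃ σ, I (min m κ.bound) σ (κ'.tmp t) ∧ κ'.toStore = σ.setReg r (κ.reg r)) ∧
        ∀ u < t, κ'.tmp u = κ.tmp u := by
  have hloop {κ₀ : Config} (h : ForLoopInvariant I r t (min m κ.bound) κ 0 κ₀) :=
    Runs.loop (O := O) (l := .tmp (t + 1)) h
      (fun v κ' h => by rw [Config.get, h.remaining, Nat.sub_eq_zero_iff_le])
      fun v _ κ' h => Runs.forLoop_body h (hbody v)
  refine (Runs.seq_eq (.sub (isUpdate_setTmp _ _ _)) <|
    Runs.seq_eq (.sub (isUpdate_setTmp _ _ _)) <| Runs.seq_eq (.const (isUpdate_setTmp _ _ _)) <|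
    Runs.seq_eq (.add (isUpdate_setTmp _ _ _)) <| (hloop ?_).seq fun κ' h =>
      .mono (.add (isUpdate_setReg _ _ _)) le_rfl ?_).mono ?_ fun _ h => h
  · constructor
    · simpa [setTmp] using h₀
    · simp [setTmp, Config.get, hm, Nat.sub_sub_eq_min]
    · simp [setTmp]
    · simp [setTmp, Config.get]
    · intro u hu
      have : u ≠ t + 1 ∧ u ≠ t + 2 ∧ u ≠ t + 3 := by omega
      simp [setTmp, this]
  · rintro _ rfl
    refine ⟨⟨κ'.toStore, h.inv, ?_⟩, fun u hu => h.tmp_eq hu⟩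
    simp [Config.setReg, Config.get, h.saved]
  · have := Nat.mul_le_mul_right (T + 4) (min_le_right m κ.bound)
    linarith

end ForLoop

/-- The code which leaves the value of `e` in the temporary register `t`, and which changes no
temporary register below `t`. -/
def Expr.compile : Expr → ℕ → Prog
  | const k, t => .const (Loc.tmp t).num k
  | var r, t => .add (Loc.tmp t).num (Loc.reg r).num Loc.zero.num
  | bound, t => .add (Loc.tmp t).num Loc.bound.num Loc.zero.num
  | add a b, t => .seq (a.compile t) <| .seq (b.compile (t + 1)) <|
      .add (Loc.tmp t).num (Loc.tmp t).num (Loc.tmp (t + 1)).num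
  | sub a b, t => .seq (a.compile t) <| .seq (b.compile (t + 1)) <|
      .sub (Loc.tmp t).num (Loc.tmp t).num (Loc.tmp (t + 1)).num
  | load A i, t => .seq (i.compile t) <| .load (Loc.tmp t).num A.num (Loc.tmp t).num
  | ite c a b, t => .seq (c.compile t) <| .ite (Loc.tmp t).num (a.compile t) (b.compile t)
  | sum r m e, t => .seq (.const (Loc.tmp t).num 0) <| .seq (m.compile (t + 1)) <|
      forLoop r t <| .seq (e.compile (t + 4)) <|
        .add (Loc.tmp t).num (Loc.tmp t).num (Loc.tmp (t + 4)).num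

/-- The code `c` leaves the value of `f` in the temporary register `t`, in time `p` of the bound. -/
def Computes (O : List Bool → List Bool) (c : Prog) (t : ℕ) (f : Store → ℕ) (p : Polynomial ℕ) :
    Prop :=
  ∀ κ : Config, Runs O c κ (p.eval κ.bound) fun κ' =>
    κ'.toStore = κ.toStore ∧ κ'.tmp t = f κ.toStore ∧ ∀ u < t, κ'.tmp u = κ.tmp u

namespace Computes

variable {O : List Bool → List Bool} {c d : Prog} {f g h : Store → ℕ} {t : ℕ} {l : Loc}
  {p q r : Polynomial ℕ}

theorem of_instruction (hc : ∀ κ : Config, Runs O c κ 1 (· = κ.setTmp t (f κ.toStore))) :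
    Computes O c t f 1 := fun κ =>
  (hc κ).mono (by simp) fun κ' hκ' => by
    subst hκ'
    exact ⟨rfl, by simp [Config.setTmp], fun u hu => by simp [Config.setTmp, hu.ne]⟩

/-- Two operands are evaluated one after the other, and an instruction combines their values. -/
theorem binop {b : Prog} {op : ℕ → ℕ → ℕ} (hc : Computes O c t f p)
    (hd : Computes O d (t + 1) g q)
    (hb : ∀ κ : Config, Runs O b κ 1 (· = κ.setTmp t (op (κ.tmp t) (κ.tmp (t + 1))))) :
    Computes O (.seq c (.seq d b)) t (fun σ => op (f σ) (g σ)) (p + (q + 1)) := fun κ => by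
  refine ((hc κ).seq fun κ₁ ⟨hσ₁, hv₁, htmp₁⟩ => (((hd κ₁).seq fun κ₂ ⟨hσ₂, hv₂, htmp₂⟩ =>
    (hb κ₂).mono le_rfl ?_).mono (T' := (q + 1).eval κ.bound) ?_ fun _ h => h)).mono ?_
      fun _ h => h
  · rintro _ rfl
    refine ⟨hσ₂.trans hσ₁, ?_, fun u hu => ?_⟩
    · simp [Config.setTmp, htmp₂, hv₁, hv₂, hσ₁]
    · simp [Config.setTmp, hu.ne, htmp₂ u (by omega), htmp₁ u hu]
  · rw [show κ₁.bound = κ.bound from congrArg Store.bound hσ₁]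
    simp
  · simp

theorem load {A : Arr} (hc : Computes O c t f p) :
    Computes O (.seq c (.load (Loc.tmp t).num A.num (Loc.tmp t).num)) t
      (fun σ => σ.mem A (f σ)) (p + 1) := fun κ => by
  refine ((hc κ).seq fun κ₁ ⟨hσ₁, hv₁, htmp₁⟩ =>
    (Runs.load (κ₁.isUpdate_setTmp _ _)).mono le_rfl ?_).mono (by simp) fun _ h => h
  rintro _ rfl
  refine ⟨hσ₁, ?_, fun u hu => ?_⟩
  · simp [Config.setTmp, Config.get, hv₁, hσ₁]
  · simp [Config.setTmp, hu.ne, htmp₁ u hu]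

theorem ite {a b : Prog} (hc : Computes O c t f p) (ha : Computes O a t g q)
    (hb : Computes O b t h r) :
    Computes O (.seq c (.ite (Loc.tmp t).num a b)) t
      (fun σ => if f σ ≠ 0 then g σ else h σ) (p + (q + r + 1)) := fun κ => by
  refine ((hc κ).seq (T' := (q + r + 1).eval κ.bound) fun κ₁ ⟨hσ₁, hv₁, htmp₁⟩ => ?_).mono
    (by simp) fun _ h => h
  have hbound : κ₁.bound = κ.bound := congrArg Store.bound hσ₁
  refine (Runs.ite (T := (q + r).eval κ₁.bound) (fun hne => ?_) fun heq => ?_).mono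
    (by simp [hbound]) fun _ h => h
  · refine (ha κ₁).mono (by simp) fun κ₂ ⟨hσ₂, hv₂, htmp₂⟩ => ?_
    rw [Config.get, hv₁] at hne
    exact ⟨hσ₂.trans hσ₁, by simp [hv₂, hσ₁, hne], fun u hu => (htmp₂ u hu).trans (htmp₁ u hu)⟩
  · refine (hb κ₁).mono (by simp) fun κ₂ ⟨hσ₂, hv₂, htmp₂⟩ => ?_
    rw [Config.get, hv₁] at heq
    exact ⟨hσ₂.trans hσ₁, by simp [hv₂, hσ₁, heq], fun u hu => (htmp₂ u hu).trans (htmp₁ u hu)⟩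

theorem sum_body (hd : Computes O d (t + 4) g q) {reg : Reg} {σ : Store} {v : ℕ} {κ : Config}
    (hσ : ∀ w, κ.toStore.setReg reg w = σ.setReg reg w)
    (hsum : κ.tmp t = ∑ w ∈ Finset.range v, g (σ.setReg reg w)) :
    Runs O (.seq d (.add (Loc.tmp t).num (Loc.tmp t).num (Loc.tmp (t + 4)).num))
      (κ.setReg reg v) ((q + 1).eval σ.bound) fun κ' =>
        ((∀ w, κ'.toStore.setReg reg w = σ.setReg reg w) ∧
          κ'.tmp t = ∑ w ∈ Finset.range (v + 1), g (σ.setReg reg w)) ∧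
        ∀ u < t + 4, u ≠ t → κ'.tmp u = κ.tmp u := by
  have hbound : κ.bound = σ.bound := by simpa [Store.setReg] using congrArg Store.bound (hσ v)
  refine ((hd _).seq fun κ₁ ⟨hσ₁, hv₁, htmp₁⟩ =>
    (Runs.add (κ₁.isUpdate_setTmp _ _)).mono le_rfl ?_).mono
      (by simp [Config.setReg, Store.setReg, hbound]) fun _ h => h
  have hσ₁ : κ₁.toStore = σ.setReg reg v := hσ₁.trans (hσ v)
  have hv₁ : κ₁.tmp (t + 4) = g (σ.setReg reg v) := hv₁.trans (congrArg g (hσ v))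
  have htmp₁ : ∀ u < t + 4, κ₁.tmp u = κ.tmp u := htmp₁
  rintro _ rfl
  refine ⟨⟨fun w => ?_, ?_⟩, fun u hu hne => ?_⟩
  · simp [Config.setTmp, hσ₁, Store.setReg]
  · simp [Config.setTmp, Config.get, hv₁, htmp₁, hsum, Finset.sum_range_succ]
  · simp [Config.setTmp, hne, htmp₁ u hu]

theorem sum {reg : Reg} (hc : Computes O c (t + 1) f p) (hd : Computes O d (t + 4) g q) :
    Computes O (.seq (.const (Loc.tmp t).num 0) <| .seq c <| forLoop reg t <|
        .seq d <| .add (Loc.tmp t).num (Loc.tmp t).num (Loc.tmp (t + 4)).num) t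
      (fun σ => ∑ v ∈ Finset.range (min (f σ) σ.bound), g (σ.setReg reg v))
      (1 + (p + (.X * (q + 5) + 6))) := fun κ => by
  refine (Runs.seq_eq (.const (κ.isUpdate_setTmp _ _)) <| (hc _).seq
    (T' := κ.bound * (q.eval κ.bound + 5) + 6) fun κ₁ ⟨hσ₁, hv₁, htmp₁⟩ => ?_).mono
      (le_of_eq (by simp [Config.setTmp])) fun _ h => h
  have hσ₁ : κ₁.toStore = κ.toStore := hσ₁
  have hbound : κ₁.bound = κ.bound := congrArg Store.bound hσ₁
  refine (Runs.forLoop hv₁ (T := (q + 1).eval κ.bound)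
    (I := fun v σ a => (∀ w, σ.setReg reg w = κ.toStore.setReg reg w) ∧
      a = ∑ w ∈ Finset.range v, g (κ.toStore.setReg reg w)) ?_ fun v κ₂ ⟨hσ₂, hsum⟩ =>
        hd.sum_body hσ₂ hsum).mono (by simp [hbound]) ?_
  · simp [hσ₁, htmp₁, Config.setTmp]
  · rintro κ₃ ⟨⟨σ, ⟨hσ, hsum⟩, hσ₃⟩, htmp₃⟩
    refine ⟨?_, hsum.trans (by rw [hbound]; rfl), fun u hu => ?_⟩
    · rw [hσ₃, hσ, show κ₁.reg = κ.reg from congrArg Store.reg hσ₁]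
      simp [Store.setReg]
    · rw [htmp₃ u hu, htmp₁ u (by omega)]
      simp [Config.setTmp, hu.ne]

end Computes

theorem Expr.exists_computes (e : Expr) (t : ℕ) :
    ∃ p, ∀ O, Computes O (e.compile t) t e.eval p := by
  induction e generalizing t with
  | const k => exact ⟨_, fun O => .of_instruction fun κ => .const (κ.isUpdate_setTmp _ _)⟩
  | var r => exact ⟨_, fun O => .of_instruction fun κ => .add (κ.isUpdate_setTmp _ _)⟩
  | bound => exact ⟨_, fun O => .of_instruction fun κ => .add (κ.isUpdate_setTmp _ _)⟩
  | add a b iha ihb =>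
    obtain ⟨⟨p, hp⟩, q, hq⟩ := And.intro (iha t) (ihb (t + 1))
    exact ⟨_, fun O => (hp O).binop (hq O) fun κ => .add (κ.isUpdate_setTmp _ _)⟩
  | sub a b iha ihb =>
    obtain ⟨⟨p, hp⟩, q, hq⟩ := And.intro (iha t) (ihb (t + 1))
    exact ⟨_, fun O => (hp O).binop (hq O) fun κ => .sub (κ.isUpdate_setTmp _ _)⟩
  | load A i ih =>
    obtain ⟨p, hp⟩ := ih t
    exact ⟨_, fun O => (hp O).load⟩
  | ite c a b ihc iha ihb =>
    obtain ⟨⟨p, hp⟩, ⟨q, hq⟩, r, hr⟩ := And.intro (ihc t) (And.intro (iha t) (ihb t))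
    exact ⟨_, fun O => (hp O).ite (hq O) (hr O)⟩
  | sum r m e ihm ihe =>
    obtain ⟨⟨p, hp⟩, q, hq⟩ := And.intro (ihm (t + 1)) (ihe (t + 4))
    exact ⟨_, fun O => (hp O).sum (hq O)⟩

/-! ### Commands -/

/-- The code for a command, which changes no temporary register below `t`. -/
def Cmd.compile : Cmd → ℕ → Prog
  | set r e, t => .seq (e.compile t) (.add (Loc.reg r).num (Loc.tmp t).num Loc.zero.num)
  | store A i e, t => .seq (i.compile t) <| .seq (e.compile (t + 1)) <|
      .store A.num (Loc.tmp t).num (Loc.tmp (t + 1)).num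
  | push e, t => .seq (e.compile t) <|
      .seq (.ite (Loc.tmp t).num (.const (Loc.tmp t).num 2) (.const (Loc.tmp t).num 1)) <|
      .seq (.store bufNum Loc.length.num (Loc.tmp t).num) <|
      .add Loc.length.num Loc.length.num Loc.one.num
  | ask, _ => .seq (.store bufNum Loc.length.num Loc.zero.num) <|
      .seq (.query bufNum Arr.answer.num) (.const Loc.length.num 0)
  | seq c d, t => .seq (c.compile t) (d.compile t)
  | loop r m c, t => .seq (m.compile (t + 1)) (forLoop r t (c.compile (t + 4)))

/-- The code `c` transforms the store by `f`, in time `p` of the bound, and preserves the first `t`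
temporary registers. -/
def Transforms (O : List Bool → List Bool) (c : Prog) (t : ℕ) (f : Store → Store)
    (p : Polynomial ℕ) : Prop :=
  ∀ κ : Config, Runs O c κ (p.eval κ.bound) fun κ' =>
    κ'.toStore = f κ.toStore ∧ ∀ u < t, κ'.tmp u = κ.tmp u

theorem cells_append_singleton_of_lt {w : List Bool} {b : Bool} {i : ℕ} (hi : i < w.length) :
    cells (w ++ [b]) i = cells w i := by
  simp only [cells, List.getElem?_append_left hi]

theorem cells_append_singleton_length {w : List Bool} {b : Bool} :
    cells (w ++ [b]) w.length = if b then 2 else 1 := by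
  cases b <;> simp [cells]

namespace Config

variable {κ : Config} {s : State}

def append (κ : Config) (w : List Bool) : Config :=
  { κ with toStore := κ.toStore.append w }

theorem RepresentedBy.append (hs : κ.RepresentedBy s) {b : Bool} {v : ℕ}
    (hv : v = if b then 2 else 1) :
    (κ.append [b]).RepresentedBy ((s.setCell bufNum (s.reg Loc.length.num) v).setReg
      Loc.length.num (s.reg Loc.length.num + s.reg Loc.one.num)) where
  reg_num l := by
    by_cases hl : l = .length
    · subst hl
      simp [State.setReg, hs.reg_num, get, Config.append, Store.append]
    · have : κ.get l = (κ.append [b]).get l := by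
        cases l <;> first | rfl | exact absurd rfl hl
      rw [← this, ← hs.reg_num]
      simp [State.setReg, State.setCell, State.setArray, hl]
  mem_num A := by
    simp [State.setReg, State.setCell, State.setArray, A.num_ne_bufNum, hs.mem_num, Config.append,
      Store.append]
  mem_buf {i} hi := by
    obtain hi | rfl : i < κ.buf.length ∨ i = κ.buf.length := by
      simpa [Config.append, Store.append, Nat.lt_succ_iff, le_iff_lt_or_eq] using hi
    · simp [State.setReg, State.setCell, State.setArray, hs.reg_num, get, hi.ne, hs.mem_buf hi,
        Config.append, Store.append, cells_append_singleton_of_lt hi]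
    · simp [State.setReg, State.setCell, State.setArray, hs.reg_num, get, hv,
        Config.append, Store.append, cells_append_singleton_length]

end Config

theorem Runs.push {O : List Bool → List Bool} {κ : Config} {b : Bool} {l : Loc}
    (hl : κ.get l = if b then 2 else 1) :
    Runs O (.seq (.store bufNum Loc.length.num l.num)
      (.add Loc.length.num Loc.length.num Loc.one.num)) κ 3 (· = κ.append [b]) := by
  intro s hs
  have hexec := (Exec.store (O := O) s bufNum Loc.length.num l.num).seq
    (.add _ Loc.length.num Loc.length.num Loc.one.num)
  refine ⟨_, _, _, hexec, ?_, hs.append ((hs.reg_num l).trans hl), rfl⟩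
  simp only [Config.append, Store.append, List.length_append, List.length_singleton]
  omega

theorem Config.RepresentedBy.holds_terminated {κ : Config} {s : State} (hs : κ.RepresentedBy s) :
    Holds ((s.setCell bufNum (s.reg Loc.length.num) (s.reg Loc.zero.num)).mem bufNum) κ.buf := by
  intro i hi
  obtain hi | rfl := hi.lt_or_eq
  · simp [State.setCell, State.setArray, hs.reg_num, get, hi.ne, hs.mem_buf hi]
  · simp [State.setCell, State.setArray, hs.reg_num, get, cells]

/-- The configuration after a query. -/
def Config.ask (κ : Config) (O : List Bool → List Bool) : Config :=
  { κ with toStore := { κ.toStore.setArray .answer (cells (O κ.buf)) with buf := [] } }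

theorem Runs.ask {O : List Bool → List Bool} {κ : Config} :
    Runs O (.seq (.store bufNum Loc.length.num Loc.zero.num) <|
      .seq (.query bufNum Arr.answer.num) (.const Loc.length.num 0)) κ 3 (· = κ.ask O) := by
  intro s hs
  have hexec := (Exec.store (O := O) s bufNum Loc.length.num Loc.zero.num).seq <|
    (Exec.query _ bufNum Arr.answer.num κ.buf hs.holds_terminated).seq <|
      .const _ Loc.length.num 0
  refine ⟨_, κ.ask O, _, hexec, ?_, ⟨fun l => ?_, fun A => ?_, fun hi => ?_⟩, rfl⟩
  · simp only [Config.ask, List.length_nil]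
    omega
  · by_cases hl : l = .length
    · subst hl
      simp [State.setReg, Config.get, Config.ask]
    · have : κ.get l = (κ.ask O).get l := by
        cases l <;> first | rfl | exact absurd rfl hl
      rw [← this, ← hs.reg_num]
      simp [State.setReg, State.setCell, State.setArray, hl]
  · simp [State.setReg, State.setCell, State.setArray, Function.update_apply, Config.ask,
      Store.setArray, Arr.num_injective.eq_iff, A.num_ne_bufNum, hs.mem_num]
  · simp [Config.ask] at hi

theorem Cmd.bound_run (O : List Bool → List Bool) (c : Cmd) (σ : Store) :
    (c.run O σ).bound = σ.bound := by
  induction c generalizing σ with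
  | seq c d ihc ihd => exact (ihd _).trans (ihc σ)
  | loop r m c ih =>
    suffices ∀ k, ((List.range k).foldl (fun σ v => c.run O (σ.setReg r v)) σ).bound = σ.bound from
      this _
    intro k
    induction k with
    | zero => rfl
    | succ k ihk => simpa [List.range_succ, ih, Store.setReg] using ihk
  | _ => rfl

namespace Transforms

variable {O : List Bool → List Bool} {c d : Prog} {t : ℕ} {p q : Polynomial ℕ} {f g : Store → ℕ}
  {F F' : Store → Store}

theorem set {r : Reg} (hc : Computes O c t f p) :
    Transforms O (.seq c (.add (Loc.reg r).num (Loc.tmp t).num Loc.zero.num)) t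
      (fun σ => σ.setReg r (f σ)) (p + 1) := fun κ => by
  refine ((hc κ).seq fun κ₁ ⟨hσ₁, hv₁, htmp₁⟩ =>
    (Runs.add (κ₁.isUpdate_setReg _ _)).mono le_rfl ?_).mono (by simp) fun _ h => h
  rintro _ rfl
  exact ⟨by simp [Config.setReg, Config.get, hσ₁, hv₁], htmp₁⟩

theorem store {A : Arr} (hc : Computes O c t f p) (hd : Computes O d (t + 1) g q) :
    Transforms O (.seq c <| .seq d <| .store A.num (Loc.tmp t).num (Loc.tmp (t + 1)).num) t
      (fun σ => σ.setArray A (Function.update (σ.mem A) (f σ) (g σ))) (p + (q + 1)) := fun κ => by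
  refine ((hc κ).seq (T' := (q + 1).eval κ.bound) fun κ₁ ⟨hσ₁, hv₁, htmp₁⟩ =>
    ((hd κ₁).seq fun κ₂ ⟨hσ₂, hv₂, htmp₂⟩ => Runs.store.mono le_rfl ?_).mono ?_
      fun _ h => h).mono (by simp) fun _ h => h
  · rintro _ rfl
    refine ⟨?_, fun u hu => (htmp₂ u (by omega)).trans (htmp₁ u hu)⟩
    simp [Config.setArray, Config.get, hσ₂, hσ₁, hv₂, htmp₂, hv₁]
  · rw [show κ₁.bound = κ.bound from congrArg Store.bound hσ₁]
    simp

theorem push (hc : Computes O c t f p) :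
    Transforms O (.seq c <|
      .seq (.ite (Loc.tmp t).num (.const (Loc.tmp t).num 2) (.const (Loc.tmp t).num 1)) <|
      .seq (.store bufNum Loc.length.num (Loc.tmp t).num) <|
      .add Loc.length.num Loc.length.num Loc.one.num) t
      (fun σ => σ.append [decide (f σ ≠ 0)]) (p + 5) := fun κ => by
  refine ((hc κ).seq (T' := 2 + 3) fun κ₁ ⟨hσ₁, hv₁, htmp₁⟩ => Runs.seq_eq
    (κ' := κ₁.setTmp t (if f κ.toStore ≠ 0 then 2 else 1))
    (.ite (fun hne => ?_) fun heq => ?_) <|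
    (Runs.push (b := decide (f κ.toStore ≠ 0)) ?_).mono le_rfl ?_).mono (by simp) fun _ h => h
  · rw [if_pos (by rwa [Config.get, hv₁] at hne)]
    exact .const (κ₁.isUpdate_setTmp _ _)
  · rw [if_neg (by simpa [Config.get, hv₁] using heq)]
    exact .const (κ₁.isUpdate_setTmp _ _)
  · simp [Config.get, Config.setTmp]
  · rintro _ rfl
    refine ⟨by simp [Config.append, Config.setTmp, hσ₁], fun u hu => ?_⟩
    simp [Config.append, Config.setTmp, hu.ne, htmp₁ u hu]

theorem seq (hc : Transforms O c t F p) (hd : Transforms O d t F' q)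
    (hF : ∀ σ, (F σ).bound = σ.bound) : Transforms O (.seq c d) t (F' ∘ F) (p + q) := fun κ => by
  refine ((hc κ).seq (T' := q.eval κ.bound) fun κ₁ ⟨hσ₁, htmp₁⟩ =>
    (hd κ₁).mono ?_ fun κ₂ ⟨hσ₂, htmp₂⟩ => ?_).mono (by simp) fun _ h => h
  · rw [show κ₁.bound = κ.bound from (congrArg Store.bound hσ₁).trans (hF _)]
  · exact ⟨hσ₂.trans (congrArg F' hσ₁), fun u hu => (htmp₂ u hu).trans (htmp₁ u hu)⟩

theorem loop {r : Reg} (hc : Computes O c (t + 1) f p) (hd : Transforms O d (t + 4) F q)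
    (hF : ∀ σ, (F σ).bound = σ.bound) :
    Transforms O (.seq c (forLoop r t d)) t
      (fun σ => loopRun r F (min (f σ) σ.bound) σ) (p + (.X * (q + 4) + 6)) := fun κ => by
  refine ((hc κ).seq (T' := κ.bound * (q.eval κ.bound + 4) + 6)
    fun κ₁ ⟨hσ₁, hv₁, htmp₁⟩ => ?_).mono (by simp) fun _ h => h
  have hbound : κ₁.bound = κ.bound := congrArg Store.bound hσ₁
  refine (Runs.forLoop hv₁ (T := q.eval κ.bound)
    (I := fun v σ _ => σ.bound = κ.bound ∧
      σ = (List.range v).foldl (fun σ v => F (σ.setReg r v)) κ.toStore)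
    ⟨hbound, hσ₁⟩ fun v κ₂ ⟨hbound₂, hσ₂⟩ => ?_).mono (by rw [hbound]) ?_
  · refine (hd _).mono (le_of_eq (congrArg q.eval hbound₂)) fun κ₃ ⟨hσ₃, htmp₃⟩ => ?_
    refine ⟨⟨?_, ?_⟩, fun u hu _ => htmp₃ u hu⟩
    · rw [hσ₃, hF]
      exact hbound₂
    · simp only [List.range_succ, List.foldl_append, List.foldl_cons, List.foldl_nil, ← hσ₂]
      exact hσ₃
  · rintro κ₃ ⟨⟨σ, ⟨-, rfl⟩, hσ₃⟩, htmp₃⟩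
    refine ⟨?_, fun u hu => (htmp₃ u hu).trans (htmp₁ u (by omega))⟩
    rw [hσ₃, hbound, show κ₁.reg = κ.reg from congrArg Store.reg hσ₁]
    rfl

end Transforms

theorem Cmd.exists_transforms (c : Cmd) (t : ℕ) :
    ∃ p, ∀ O, Transforms O (c.compile t) t (c.run O) p := by
  induction c generalizing t with
  | set r e =>
    obtain ⟨p, hp⟩ := e.exists_computes t
    exact ⟨_, fun O => .set (hp O)⟩
  | store A i e =>
    obtain ⟨⟨p, hp⟩, q, hq⟩ := And.intro (i.exists_computes t) (e.exists_computes (t + 1))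
    exact ⟨_, fun O => .store (hp O) (hq O)⟩
  | push e =>
    obtain ⟨p, hp⟩ := e.exists_computes t
    exact ⟨_, fun O => .push (hp O)⟩
  | ask =>
    refine ⟨3, fun O κ => Runs.ask.mono (by simp) ?_⟩
    rintro _ rfl
    exact ⟨rfl, fun _ _ => rfl⟩
  | seq c d ihc ihd =>
    obtain ⟨⟨p, hp⟩, q, hq⟩ := And.intro (ihc t) (ihd t)
    exact ⟨_, fun O => (hp O).seq (hq O) (c.bound_run O)⟩
  | loop r m c ih =>
    obtain ⟨⟨p, hp⟩, q, hq⟩ := And.intro (m.exists_computes (t + 1)) (ih (t + 4))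
    exact ⟨_, fun O => .loop (hp O) (hq O) (c.bound_run O)⟩

/-! ### Reductions -/

/-- The store with bound `b` and input `x`, and otherwise blank. -/
def initStore (x : List Bool) (b : ℕ) : Store :=
  ⟨b, fun _ => 0, fun A => if A = .input then cells x else fun _ => 0, []⟩

/-- The configuration with bound `b` and input `x`, and otherwise blank. -/
def initConfig (x : List Bool) (b : ℕ) : Config :=
  { toStore := initStore x b, tmp := fun _ => 0 }

theorem representedBy_initConfig (x : List Bool) :
    (initConfig x 0).RepresentedBy ((initState x).setReg Loc.one.num 1) where
  reg_num l := by
    cases l <;>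
      simp [State.setReg, initState, State.setArray, Config.get, initConfig, initStore]
  mem_num A := by
    cases A <;> simp [State.setReg, initState, State.setArray, Arr.num, initConfig, initStore]
  mem_buf hi := by simp [initConfig, initStore] at hi

theorem Config.isUpdate_bound (κ : Config) (b : ℕ) :
    κ.IsUpdate .bound b { κ with bound := b } where
  get_eq := by
    funext l
    cases l <;> simp [get]
  mem_eq := rfl
  buf_eq := rfl

theorem cells_eq_zero_iff {x : List Bool} {i : ℕ} : cells x i = 0 ↔ x.length ≤ i := by
  rw [← List.getElem?_eq_none_iff, cells]
  split <;> simp_all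

/-- The code which advances the bound from `0` to the length of the input plus `2`. -/
def measureInput : Prog :=
  .seq (.load (Loc.tmp 0).num Arr.input.num Loc.bound.num) <|
  .seq (.loop (Loc.tmp 0).num <|
    .seq (.add Loc.bound.num Loc.bound.num Loc.one.num) <|
    .load (Loc.tmp 0).num Arr.input.num Loc.bound.num) <|
  .seq (.add Loc.bound.num Loc.bound.num Loc.one.num) <|
  .add Loc.bound.num Loc.bound.num Loc.one.num

theorem runs_measureInput {O : List Bool → List Bool} (x : List Bool) :
    Runs O measureInput (initConfig x 0) (x.length * 3 + 4) fun κ =>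
      κ.toStore = initStore x (x.length + 2) := by
  have hload (b v : ℕ) : Runs O (.load (Loc.tmp 0).num Arr.input.num Loc.bound.num)
      ((initConfig x b).setTmp 0 v) 1 (· = (initConfig x b).setTmp 0 (cells x b)) := by
    have h := ((initConfig x b).setTmp 0 v).isUpdate_setTmp 0 (cells x b)
    rw [show ((initConfig x b).setTmp 0 v).setTmp 0 (cells x b) =
      (initConfig x b).setTmp 0 (cells x b) by simp [Config.setTmp]] at h
    exact .load h
  have hadd (b v : ℕ) : Runs O (.add Loc.bound.num Loc.bound.num Loc.one.num)
      ((initConfig x b).setTmp 0 v) 1 (· = (initConfig x (b + 1)).setTmp 0 v) :=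
    .add (((initConfig x b).setTmp 0 v).isUpdate_bound _)
  have hstart : (initConfig x 0).setTmp 0 0 = initConfig x 0 := by
    simp [Config.setTmp, initConfig]
  have hloop := Runs.loop (O := O) (l := .tmp 0) (k := x.length)
    (I := fun v κ => κ = (initConfig x v).setTmp 0 (cells x v)) rfl
    (by rintro v _ rfl; simp [Config.get, Config.setTmp, cells_eq_zero_iff])
    (by rintro v - _ rfl; exact (hadd v _).seq_eq (hload (v + 1) _))
  refine ((hstart ▸ hload 0 0).seq_eq <| hloop.seq_eq <| (hadd _ _).seq_eq <|
    (hadd _ _).mono le_rfl ?_).mono (by omega) fun _ h => h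
  rintro _ rfl
  rfl

theorem polyTimeTuringReducible_of_run {P Q : SearchProblem} (c : Cmd)
    (hc : ∀ O, Q.SolvedBy O → ∀ I, P.IsAnswer I
      (c.run O (initStore (P.encode I) ((P.encode I).length + 2))).buf) :
    PolyTimeTuringReducible P Q := by
  obtain ⟨p, hp⟩ := c.exists_transforms 0
  refine ⟨.seq (.const Loc.one.num 1) <| .seq (.seq measureInput (c.compile 0)) <|
    .store bufNum Loc.length.num Loc.zero.num, .X * 3 + 6 + p.comp (.X + 2), fun O hO I => ?_⟩
  set x := P.encode I
  obtain ⟨s, κ, t, hexec, ht, hs, hκ⟩ := (runs_measureInput x).seq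
    (T' := p.eval (x.length + 2)) (Q := fun κ => κ.toStore = c.run O (initStore x (x.length + 2)))
    (fun κ hκ => (hp O κ).mono (by rw [hκ, initStore]) fun κ' h => h.1.trans (by rw [hκ]))
    _ (representedBy_initConfig x)
  refine ⟨_, hc O hO I, _, _, (Exec.const _ _ _).seq (hexec.seq (.store _ _ _ _)), ?_,
    hκ ▸ hs.holds_terminated⟩
  simp only [initConfig, initStore, List.length_nil] at ht
  simp only [Polynomial.eval_add, Polynomial.eval_mul, Polynomial.eval_comp, Polynomial.eval_X,
    Polynomial.eval_ofNat]
  omega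

end LoopProgram

/-! ### Derived expressions -/

namespace LoopProgram

open OracleRAM

namespace Store

variable (σ : Store) (r r' : Reg) (v : ℕ)

@[simp]
theorem bound_setReg : (σ.setReg r v).bound = σ.bound := (rfl)

@[simp]
theorem mem_setReg : (σ.setReg r v).mem = σ.mem := (rfl)

@[simp]
theorem reg_setReg : (σ.setReg r v).reg r' = if r' = r then v else σ.reg r' :=
  Function.update_apply _ _ _ _

variable (A B : Arr) (f : ℕ → ℕ)

@[simp]
theorem reg_setArray : (σ.setArray A f).reg = σ.reg := (rfl)

@[simp]
theorem buf_setArray : (σ.setArray A f).buf = σ.buf := (rfl)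

@[simp]
theorem mem_setArray : (σ.setArray A f).mem B = if B = A then f else σ.mem B :=
  Function.update_apply _ _ _ _

theorem setReg_setReg (x : ℕ) : (σ.setReg r v).setReg r x = σ.setReg r x := by
  simp only [setReg, Function.update_idem]

end Store

open Store

theorem loopRun_induction {r : Reg} {f : Store → Store} {k : ℕ} {σ : Store} {P : ℕ → Store → Prop}
    (setReg : ∀ v τ x, P v τ → P v (τ.setReg r x)) (zero : P 0 σ)
    (succ : ∀ v < k, ∀ τ, P v τ → P (v + 1) (f (τ.setReg r v))) : P k (loopRun r f k σ) := by
  suffices ∀ j ≤ k, P j ((List.range j).foldl (fun τ v => f (τ.setReg r v)) σ) from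
    setReg _ _ _ (this k le_rfl)
  intro j hj
  induction j with
  | zero => exact zero
  | succ j ih =>
    rw [List.range_succ, List.foldl_append]
    exact succ j hj _ (ih (Nat.le_of_succ_le hj))

namespace Expr

instance : Coe Reg Expr := ⟨var⟩

instance (k : ℕ) : OfNat Expr k := ⟨const k⟩

instance : Add Expr := ⟨add⟩

instance : Sub Expr := ⟨sub⟩

section

variable (σ : Store)

@[simp]
theorem eval_var (r : Reg) : (var r).eval σ = σ.reg r := (rfl)

@[simp]
theorem eval_bound : bound.eval σ = σ.bound := rfl

@[simp]
theorem eval_ofNat (k : ℕ) : (no_index (OfNat.ofNat k) : Expr).eval σ = OfNat.ofNat k := (rfl)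

@[simp]
theorem eval_add (a b : Expr) : (a + b).eval σ = a.eval σ + b.eval σ := (rfl)

@[simp]
theorem eval_sub (a b : Expr) : (a - b).eval σ = a.eval σ - b.eval σ := (rfl)

@[simp]
theorem eval_load (A : Arr) (i : Expr) : (load A i).eval σ = σ.mem A (i.eval σ) := rfl

end

/-- As a truth value, a number is read as true if it is nonzero. -/
def Holds (e : Expr) (σ : Store) : Prop := e.eval σ ≠ 0

protected def not (a : Expr) : Expr := 1 - a

protected def and (a b : Expr) : Expr := ite a b 0

protected def or (a b : Expr) : Expr := ite a 1 b

def le (a b : Expr) : Expr := (a - b).not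

def lt (a b : Expr) : Expr := b - a

def eq (a b : Expr) : Expr := (le a b).and (le b a)

def implies (a b : Expr) : Expr := a.not.or b

def ex (r : Reg) (m e : Expr) : Expr := sum r m e

def all (r : Reg) (m e : Expr) : Expr := (ex r m e.not).not

def count (r : Reg) (m e : Expr) : Expr := sum r m (ite e 1 0)

def mul (a b : Expr) : Expr := sum .factor a b

/-- The entry in row `a` and column `b` of an `n × n` matrix stored in `A` from `start` on. -/
def entry (A : Arr) (start n a b : Expr) : Expr :=
  eq (load A (start + (b + mul n a))) 2

instance (e : Expr) (σ : Store) : Decidable (e.Holds σ) := instDecidableNot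

@[simp]
theorem eval_ite (c a b : Expr) (σ : Store) :
    (ite c a b).eval σ = if c.Holds σ then a.eval σ else b.eval σ := rfl

variable {σ : Store} {a b : Expr}

@[simp]
theorem holds_not : a.not.Holds σ ↔ ¬a.Holds σ := by
  simp only [Holds, Expr.not, eval_sub, eval_ofNat]
  omega

@[simp]
theorem holds_and : (a.and b).Holds σ ↔ a.Holds σ ∧ b.Holds σ := by
  simp only [Holds, Expr.and, eval]
  split_ifs <;> simp_all

@[simp]
theorem holds_or : (a.or b).Holds σ ↔ a.Holds σ ∨ b.Holds σ := by
  simp only [Holds, Expr.or, eval]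
  split_ifs <;> simp_all

@[simp]
theorem holds_le : (le a b).Holds σ ↔ a.eval σ ≤ b.eval σ := by
  rw [le, holds_not, Holds, not_not, eval_sub, Nat.sub_eq_zero_iff_le]

@[simp]
theorem holds_lt : (lt a b).Holds σ ↔ a.eval σ < b.eval σ := by
  rw [Holds, lt, eval_sub, Nat.sub_ne_zero_iff_lt]

@[simp]
theorem holds_eq : (eq a b).Holds σ ↔ a.eval σ = b.eval σ := by
  rw [eq, holds_and, holds_le, holds_le, le_antisymm_iff]

@[simp]
theorem holds_implies : (implies a b).Holds σ ↔ (a.Holds σ → b.Holds σ) := by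
  rw [implies, holds_or, holds_not, imp_iff_not_or]

theorem holds_ex {r : Reg} {m e : Expr} {k : ℕ} (hm : m.eval σ = k) (hk : k ≤ σ.bound) :
    (ex r m e).Holds σ ↔ ∃ v : Fin k, e.Holds (σ.setReg r v) := by
  simp [Holds, ex, eval, hm, hk, Fin.exists_iff]

theorem holds_all {r : Reg} {m e : Expr} {k : ℕ} (hm : m.eval σ = k) (hk : k ≤ σ.bound) :
    (all r m e).Holds σ ↔ ∀ v : Fin k, e.Holds (σ.setReg r v) := by
  rw [all, holds_not, holds_ex hm hk]
  simp

theorem eval_count {r : Reg} {m e : Expr} {k n : ℕ} (hm : m.eval σ = k) (hk : k ≤ σ.bound)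
    (hn : n ≤ k) (he : ∀ v < k, e.Holds (σ.setReg r v) ↔ v < n) : (count r m e).eval σ = n := by
  classical
  calc (count r m e).eval σ
    _ = ∑ v ∈ Finset.range k, if e.Holds (σ.setReg r v) then 1 else 0 := by
      simp only [count, eval, hm, min_eq_left hk, Holds]
    _ = ∑ v ∈ Finset.range k, if v < n then 1 else 0 :=
      Finset.sum_congr rfl fun v hv => by simp only [he v (Finset.mem_range.1 hv)]
    _ = n := by
      rw [Finset.sum_boole, Finset.range_eq_Ico, Finset.Ico_filter_lt, min_eq_right hn]
      simp

theorem eval_mul (ha : a.eval σ ≤ σ.bound) (hb : ∀ v, b.eval (σ.setReg .factor v) = b.eval σ) :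
    (mul a b).eval σ = a.eval σ * b.eval σ := by
  simp [mul, eval, ha, hb]

theorem holds_entry {A : Arr} {start n : Expr} (hn : n.eval σ ≤ σ.bound)
    (ha : ∀ v, a.eval (σ.setReg .factor v) = a.eval σ) :
    (entry A start n a b).Holds σ ↔
      σ.mem A (start.eval σ + (b.eval σ + n.eval σ * a.eval σ)) = 2 := by
  simp [entry, eval_mul hn ha]

theorem eval_append (w : List Bool) (e : Expr) : e.eval (σ.append w) = e.eval σ := by
  induction e generalizing σ with
  | sum r m e ihm ihe => simp only [eval, ihm, ← ihe (σ := σ.setReg r _)]; rfl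
  | _ => simp_all [eval, Store.append]

end Expr

theorem Cmd.run_push {O : List Bool → List Bool} {e : Expr} {σ : Store} [Decidable (e.Holds σ)] :
    Cmd.run O (.push e) σ = σ.append [decide (e.Holds σ)] := by
  rw [Cmd.run]
  congr

/-! ### Programs that write strings -/

/-- Run from `σ`, the program `c` does nothing but append `w` to the string written so far. -/
def Writes (O : List Bool → List Bool) (c : Cmd) (σ : Store) (w : List Bool) : Prop :=
  ∀ u, c.run O (σ.append u) = (σ.append u).append w

namespace Writes

variable {O : List Bool → List Bool} {c d : Cmd} {σ : Store} {w w' : List Bool}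

theorem run_eq (h : Writes O c σ w) : c.run O σ = σ.append w := by
  simpa [Store.append] using h []

theorem push (e : Expr) {_ : Decidable (e.Holds σ)} : Writes O (.push e) σ [decide (e.Holds σ)] :=
  fun u => by
    rw [Cmd.run, Expr.eval_append]
    congr

theorem seq (hc : Writes O c σ w) (hd : Writes O d σ w') :
    Writes O (.seq c d) σ (w ++ w') := fun u => by
  have append_append (u v : List Bool) : (σ.append u).append v = σ.append (u ++ v) := by
    simp [Store.append]
  rw [Cmd.run, hc, append_append, hd]
  simp only [append_append, List.append_assoc]

theorem run_seq_ask (h : Writes O c σ w) (hσ : σ.buf = []) :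
    Cmd.run O (.seq c .ask) σ = σ.setArray .answer (cells (O w)) := by
  simp [Cmd.run, h.run_eq, Store.append, Store.setArray, hσ]

theorem loop {r : Reg} {m : Expr} {k : ℕ} {g : Fin k → List Bool} (hm : m.eval σ = k)
    (hk : k ≤ σ.bound) (hc : ∀ v : Fin k, Writes O c (σ.setReg r v) (g v)) :
    Writes O (.loop r m c) σ (List.ofFn g).flatten := fun u => by
  have hbound : min (m.eval (σ.append u)) (σ.append u).bound = k := by
    rw [Expr.eval_append, hm]
    exact min_eq_left hk
  have hwritten := loopRun_induction (r := r) (f := c.run O) (k := k) (σ := σ.append u)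
    (P := fun v τ => τ.setReg r (σ.reg r) = (σ.append u).append ((List.ofFn g).take v).flatten)
    (fun v τ x h => by rw [setReg_setReg, h]) (by simp [Store.append, Store.setReg])
    (fun v hv τ h => by
      have hτ : τ.setReg r v = (σ.setReg r v).append (u ++ ((List.ofFn g).take v).flatten) := by
        rw [← setReg_setReg τ r (σ.reg r), h]
        simp [Store.append, Store.setReg]
      have hg : (List.ofFn g)[v]? = some (g ⟨v, hv⟩) := by simp [hv]
      rw [hτ, hc ⟨v, hv⟩, List.take_add_one, hg]
      simp [Store.append, Store.setReg])
  rw [Cmd.run, hbound]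
  rwa [List.take_of_length_le (by simp), loopRun, setReg_setReg] at hwritten

end Writes

end LoopProgram

/-! ### Encoded graphs -/

/-- The code of a binary relation on `Fin n` in the format used for graphs. -/
noncomputable def relationCode {n : ℕ} (r : Fin n → Fin n → Prop) : List Bool :=
  List.replicate n true ++ false :: matrixBits r

theorem divNat_modNat_finProdFinEquiv {n : ℕ} (r : Fin n → Fin n → Prop) (i j : Fin n) :
    r (finProdFinEquiv (i, j)).divNat (finProdFinEquiv (i, j)).modNat = r i j :=
  congrArg (fun p => r p.1 p.2) (finProdFinEquiv.symm_apply_apply (i, j))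

namespace OracleRAM

theorem cells_append_right (u w : List Bool) (i : ℕ) :
    cells (u ++ w) (u.length + i) = cells w i := by
  simp [cells, List.getElem?_append_right]

theorem cells_eq_two_iff {w : List Bool} {i : ℕ} : cells w i = 2 ↔ w[i]? = some true := by
  rcases h : w[i]? with _ | _ | _ <;> simp [cells, h]

theorem cells_replicate_append {n i : ℕ} (h : i ≤ n) (w : List Bool) :
    cells (List.replicate n true ++ false :: w) i = 2 ↔ i < n := by
  obtain h | rfl := h.lt_or_eq
  · simp [cells_eq_two_iff, List.getElem?_append_left, h]
  · simp [cells_eq_two_iff]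

theorem length_matrixBits {n : ℕ} (r : Fin n → Fin n → Prop) :
    (matrixBits r).length = n * n :=
  List.length_ofFn

theorem cells_matrixBits_append {n : ℕ} (r : Fin n → Fin n → Prop) (w : List Bool)
    (i j : Fin n) : cells (matrixBits r ++ w) (j + n * i) = 2 ↔ r i j := by
  have hk : (j + n * i : ℕ) = finProdFinEquiv (i, j) := rfl
  have hlt : (finProdFinEquiv (i, j) : ℕ) < (matrixBits r).length :=
    (Fin.is_lt _).trans_eq (length_matrixBits r).symm
  have hij := divNat_modNat_finProdFinEquiv r i j
  rw [cells_eq_two_iff, hk, List.getElem?_append_left hlt, matrixBits, List.getElem?_ofFn,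
    dif_pos (Fin.is_lt _)]
  simpa only [Option.some_inj, decide_eq_true_iff] using iff_of_eq hij

theorem cells_graphCode_append_order {n i : ℕ} (G : SimpleGraph (Fin n)) (w : List Bool)
    (h : i ≤ n) : cells (graphCode G ++ w) i = 2 ↔ i < n := by
  rw [graphCode, List.append_assoc, List.cons_append, cells_replicate_append h]

theorem cells_graphCode_append_adj {n : ℕ} (G : SimpleGraph (Fin n)) (w : List Bool)
    (i j : Fin n) : cells (graphCode G ++ w) (n + 1 + (j + n * i)) = 2 ↔ G.Adj i j := by
  have h := cells_append_right (List.replicate n true ++ [false]) (matrixBits G.Adj ++ w)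
    (j + n * i)
  rw [← cells_matrixBits_append G.Adj w, ← h]
  simp [graphCode]

theorem length_graphCode {n : ℕ} (G : SimpleGraph (Fin n)) :
    (graphCode G).length = n + 1 + n * n := by
  simp only [graphCode, List.length_append, List.length_replicate, List.length_cons,
    length_matrixBits]
  ring

theorem cells_graphCode_append_right {n : ℕ} (G : SimpleGraph (Fin n)) (w : List Bool) (i : ℕ) :
    cells (graphCode G ++ w) (n + 1 + n * n + i) = cells w i := by
  rw [← length_graphCode G, cells_append_right]

end OracleRAM

open Classical in
theorem matrixBits_eq_flatten {n : ℕ} (r : Fin n → Fin n → Prop) :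
    matrixBits r =
      (List.ofFn fun i => (List.ofFn fun j => [decide (r i j)]).flatten).flatten := by
  have flatten_ofFn_singleton {k : ℕ} (f : Fin k → Bool) :
      (List.ofFn fun j => [f j]).flatten = List.ofFn f := by
    rw [← Function.comp_def (fun b => [b]) f, ← List.map_ofFn, ← List.flatMap_def,
      List.flatMap_singleton']
  simp only [flatten_ofFn_singleton, matrixBits, List.ofFn_mul]
  congr! 5 with i j
  have hval : i * n + j = (finProdFinEquiv (i, j) : ℕ) := by
    rw [finProdFinEquiv_apply_val, mul_comm, add_comm]
  simp only [hval]
  exact decide_eq_decide.2 (iff_of_eq (divNat_modNat_finProdFinEquiv r i j))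

namespace LoopProgram

open OracleRAM Store Reg

theorem Store.setReg_eq_self (σ : Store) (r : Reg) : σ.setReg r (σ.reg r) = σ := by
  simp only [setReg, Function.update_eq_self]

namespace Cmd

/-- The program that writes the `m × m` matrix whose entry in row `row` and column `column` is the
truth value of `e`. -/
def matrix (m e : Expr) : Cmd := loop row m (loop column m (push e))

/-- The program that writes the code of a relation on `m` elements, given by `e` as a condition on
the registers `row` and `column`. -/
def relation (m e : Expr) : Cmd :=
  seq (loop row m (push 1)) (seq (push 0) (matrix m e))

end Cmd

namespace Writes

variable {O : List Bool → List Bool} {σ : Store} {m e : Expr} {n : ℕ}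

theorem matrix (hm : ∀ v, m.eval (σ.setReg row v) = n) (hn : n ≤ σ.bound) :
    Writes O (.matrix m e) σ
      (matrixBits fun i j : Fin n => e.Holds ((σ.setReg row i).setReg column j)) := by
  rw [matrixBits_eq_flatten]
  refine loop ?_ hn fun i => loop (hm i) hn fun j => push e
  rw [← hm (σ.reg row), setReg_eq_self]

theorem relation (hm : ∀ v, m.eval (σ.setReg row v) = n) (hn : n ≤ σ.bound) :
    Writes O (.relation m e) σ
      (relationCode fun i j : Fin n => e.Holds ((σ.setReg row i).setReg column j)) := by
  have hm' : m.eval σ = n := by rw [← hm (σ.reg row), setReg_eq_self]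
  have hunary : Writes O (.loop row m (.push 1)) σ (List.replicate n true) := by
    have h := loop (O := O) (r := row) (g := fun _ => [true]) hm' hn fun _ => push 1
    simpa [List.ofFn_const] using h
  have hzero : Writes O (.push 0) σ [false] := push 0
  exact hunary.seq (hzero.seq (matrix hm hn))

end Writes

namespace Expr

/-- The length of the block of ones of the input that starts at position `a`. -/
def unary (a : Expr) : Expr :=
  count column bound (all row (column + 1) (eq (load .input (a + row)) 2))

theorem eval_unary {σ : Store} {a : Expr} {o n : ℕ} (hn : n ≤ σ.bound)
    (ha : ∀ u v, a.eval ((σ.setReg column u).setReg row v) = o)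
    (hcell : ∀ i ≤ n, σ.mem .input (o + i) = 2 ↔ i < n) : (unary a).eval σ = n := by
  refine eval_count rfl le_rfl hn fun v hv => ?_
  rw [holds_all (k := v + 1) (by simp) (by simpa using hv)]
  simp only [holds_eq, eval_load, eval_add, ha, eval_var, reg_setReg, if_true, mem_setReg,
    eval_ofNat]
  refine ⟨fun h => ?_, fun h i => (hcell i (by omega)).2 (by omega)⟩
  by_contra! hnv
  exact lt_irrefl n ((hcell n le_rfl).1 (h ⟨n, by omega⟩))

end Expr

open LoopProgram.Expr

namespace Cmd

/-- The program that finds the orders and the positions of the parts of an input that starts with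
two encoded graphs. -/
def parse : Cmd :=
  seq (set order₀ (unary 0)) <|
  seq (set matrix₀ (order₀ + 1)) <|
  seq (set order₁ (unary (matrix₀ + mul order₀ order₀))) <|
  seq (set matrix₁ (matrix₀ + mul order₀ order₀ + order₁ + 1)) <|
  set matrix₂ (matrix₁ + mul order₁ order₁)

end Cmd

/-- The registers that `Cmd.parse` sets. -/
def layout : List Reg := [order₀, order₁, matrix₀, matrix₁, matrix₂]

/-- The input consists of two encoded graphs and a further string; the registers contain the orders
of the graphs and the positions of the two adjacency matrices and of the further string. -/
structure IsParsed {n m : ℕ} (G : SimpleGraph (Fin n)) (H : SimpleGraph (Fin m)) (w : List Bool)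
    (σ : Store) : Prop where
  order₀ : σ.reg order₀ = n
  order₁ : σ.reg order₁ = m
  matrix₀ (i j : Fin n) : σ.mem .input (σ.reg matrix₀ + (j + n * i)) = 2 ↔ G.Adj i j
  matrix₁ (i j : Fin m) : σ.mem .input (σ.reg matrix₁ + (j + m * i)) = 2 ↔ H.Adj i j
  matrix₂ (i : ℕ) : σ.mem .input (σ.reg matrix₂ + i) = cells w i
  le_bound : n * n + n + (m * m + m) + 4 ≤ σ.bound

theorem IsParsed.of_eq {n m : ℕ} {G : SimpleGraph (Fin n)} {H : SimpleGraph (Fin m)}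
    {w : List Bool} {σ τ : Store} (h : IsParsed G H w σ) (hbound : τ.bound = σ.bound)
    (hmem : τ.mem .input = σ.mem .input) (hreg : ∀ r ∈ layout, τ.reg r = σ.reg r) :
    IsParsed G H w τ := by
  simp only [layout, List.forall_mem_cons, List.not_mem_nil, false_implies] at hreg
  obtain ⟨h₀, h₁, h₂, h₃, h₄, -⟩ := hreg
  constructor <;> simp only [hbound, hmem, h₀, h₁, h₂, h₃, h₄]
  exacts [h.order₀, h.order₁, h.matrix₀, h.matrix₁, h.matrix₂, h.le_bound]

theorem IsParsed.setReg {n m : ℕ} {G : SimpleGraph (Fin n)} {H : SimpleGraph (Fin m)}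
    {w : List Bool} {σ : Store} (h : IsParsed G H w σ) {r : Reg} (hr : r ∉ layout) (v : ℕ) :
    IsParsed G H w (σ.setReg r v) :=
  h.of_eq rfl rfl fun r' hr' => by rw [reg_setReg, if_neg (ne_of_mem_of_not_mem hr' hr)]

theorem IsParsed.setArray {n m : ℕ} {G : SimpleGraph (Fin n)} {H : SimpleGraph (Fin m)}
    {w : List Bool} {σ : Store} (h : IsParsed G H w σ) {A : Arr} (hA : A ≠ .input) (f : ℕ → ℕ) :
    IsParsed G H w (σ.setArray A f) :=
  h.of_eq rfl (by rw [mem_setArray, if_neg hA.symm]) fun _ _ => rfl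

theorem run_parse {O : List Bool → List Bool} {n m : ℕ} {G : SimpleGraph (Fin n)}
    {H : SimpleGraph (Fin m)} {w : List Bool} {σ : Store}
    (hmem : σ.mem .input = cells (graphCode G ++ (graphCode H ++ w)))
    (hn : n ≤ σ.bound) (hm : m ≤ σ.bound) :
    Cmd.parse.run O σ = ((((σ.setReg order₀ n).setReg matrix₀ (n + 1)).setReg
      order₁ m).setReg matrix₁ (n + 1 + n * n + (m + 1))).setReg matrix₂
        (n + 1 + n * n + (m + 1 + m * m)) := by
  have order₀_eq : (unary 0).eval σ = n := by
    refine eval_unary (o := 0) hn (fun _ _ => rfl) fun i hi => ?_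
    rw [hmem, zero_add, cells_graphCode_append_order G _ hi]
  have matrix₀_eq : (order₀ + 1 : Expr).eval (σ.setReg order₀ n) = n + 1 := by simp
  have order₁_eq : (unary (matrix₀ + mul order₀ order₀)).eval
      ((σ.setReg order₀ n).setReg matrix₀ (n + 1)) = m := by
    refine eval_unary (o := n + 1 + n * n) hm (fun u v => ?_) fun i hi => ?_
    · simp [eval_mul, hn]
    · rw [mem_setReg, mem_setReg, hmem, cells_graphCode_append_right,
        cells_graphCode_append_order H _ hi]
  have matrix₁_eq : (matrix₀ + mul order₀ order₀ + order₁ + 1 : Expr).eval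
      (((σ.setReg order₀ n).setReg matrix₀ (n + 1)).setReg order₁ m) =
        n + 1 + n * n + (m + 1) := by
    simp [eval_mul, hn, add_assoc]
  have matrix₂_eq : (matrix₁ + mul order₁ order₁ : Expr).eval
      ((((σ.setReg order₀ n).setReg matrix₀ (n + 1)).setReg order₁ m).setReg matrix₁
        (n + 1 + n * n + (m + 1))) = n + 1 + n * n + (m + 1 + m * m) := by
    simp [eval_mul, hm, add_assoc]
  simp only [Cmd.parse, Cmd.run, order₀_eq, matrix₀_eq, order₁_eq, matrix₁_eq, matrix₂_eq]

theorem isParsed_parse {O : List Bool → List Bool} {n m : ℕ} {G : SimpleGraph (Fin n)}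
    {H : SimpleGraph (Fin m)} {w : List Bool} {σ : Store}
    (hmem : σ.mem .input = cells (graphCode G ++ (graphCode H ++ w)))
    (hb : (graphCode G ++ (graphCode H ++ w)).length + 2 ≤ σ.bound) :
    IsParsed G H w (Cmd.parse.run O σ) := by
  simp only [List.length_append, length_graphCode] at hb
  rw [run_parse hmem (by omega) (by omega)]
  constructor <;>
    simp only [bound_setReg, mem_setReg, reg_setReg, reduceCtorEq, if_true, if_false, hmem]
  · exact cells_graphCode_append_adj G _
  · intro i j
    rw [add_assoc, cells_graphCode_append_right, cells_graphCode_append_adj]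
  · intro i
    rw [add_assoc, cells_graphCode_append_right, cells_graphCode_append_right]
  · omega

/-! ### From automorphism reconstruction to isomorphism -/

section Pendant

/-- The number of the vertex `(a, b)` of a pendant graph over a graph of order `order₀`. -/
def Expr.pair (a b : Expr) : Expr := b + mul a (order₀ + 3)

namespace Expr

/-- The arcs of the pendant graph over the graph whose adjacency matrix starts at `M`; the label
of a vertex is given by an expression in the register `vertex`. -/
def pendantArc (M : Reg) (label : Expr) : Expr :=
  (eq part 0).and <|
    ((eq part' 0).and (entry .input M order₀ vertex vertex')).or
      ((eq part' 0).not.and ((le part' label).and (eq vertex vertex')))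

/-- The adjacency in the pendant graph over the graph whose adjacency matrix starts at `M`, as a
condition on the registers `row` and `column`. -/
def pendantAdj (M : Reg) (label : Expr) : Expr :=
  (eq row column).not.and <| ex vertex order₀ <| ex part (order₀ + 3) <|
    ex vertex' order₀ <| ex part' (order₀ + 3) <| (pendantArc M label).and <|
      ((eq row (pair vertex part)).and (eq column (pair vertex' part'))).or
        ((eq row (pair vertex' part')).and (eq column (pair vertex part)))

end Expr

variable {n : ℕ} {M : Reg} {label : Expr} {K : SimpleGraph (Fin n)} {c : ℕ → ℕ} {σ : Store}

/-- `M` points to the adjacency matrix of `K`, and `label` evaluates to `c`. -/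
structure IsLabelledGraph (K : SimpleGraph (Fin n)) (c : ℕ → ℕ) (M : Reg) (label : Expr)
    (σ : Store) : Prop where
  matrix_eq : M = matrix₀ ∨ M = matrix₁
  order_eq : σ.reg order₀ = n
  entry_eq_two_iff (i j : Fin n) : σ.mem .input (σ.reg M + (j + n * i)) = 2 ↔ K.Adj i j
  eval_label (τ : Store) (hmem : τ.mem = σ.mem) (hstage : τ.reg stage = σ.reg stage)
    (hcandidate : τ.reg candidate = σ.reg candidate) : label.eval τ = c (τ.reg vertex)
  le_bound : n * (n + 3) + 3 ≤ σ.bound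

namespace IsLabelledGraph

theorem holds_pendantArc (h : IsLabelledGraph K c M label σ) {i j : ℕ}
    (v w : Fin n) (p q : Fin (n + 3)) :
    (pendantArc M label).Holds ((((((σ.setReg row i).setReg column j).setReg vertex v).setReg
      part p).setReg vertex' w).setReg part' q) ↔
        IsPendantArc K (fun v : Fin n => c v) (v, p) (w, q) := by
  have hn : n ≤ σ.bound := by nlinarith [h.le_bound]
  obtain rfl | rfl := h.matrix_eq <;>
    simp [pendantArc, IsPendantArc, holds_entry, h.eval_label, h.entry_eq_two_iff, h.order_eq, hn,
      Fin.val_inj]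

theorem holds_pendantAdj (h : IsLabelledGraph K c M label σ) (i j : Fin (n * (n + 3))) :
    (pendantAdj M label).Holds ((σ.setReg row i).setReg column j) ↔
      ((pendantGraph K (fun v : Fin n => c v) (n + 2)).comap finProdFinEquiv.symm).Adj i j := by
  have hn3 : n + 3 ≤ σ.bound := by nlinarith [h.le_bound]
  have hn : n ≤ σ.bound := by omega
  rw [pendantGraph_comap_symm_adj, pendantAdj, holds_and]
  refine and_congr (by simp [Fin.val_inj]) ?_
  rw [holds_ex (k := n) (by simp [h.order_eq]) (by simpa)]
  refine exists_congr fun v => ?_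
  rw [holds_ex (k := n + 3) (by simp [h.order_eq]) (by simpa)]
  refine exists_congr fun p => ?_
  rw [holds_ex (k := n) (by simp [h.order_eq]) (by simpa)]
  refine exists_congr fun w => ?_
  rw [holds_ex (k := n + 3) (by simp [h.order_eq]) (by simpa)]
  refine exists_congr fun q => ?_
  rw [holds_and, h.holds_pendantArc]
  simp [pair, eval_mul, hn, h.order_eq, Fin.ext_iff, v.2.le.trans, w.2.le.trans, mul_comm]

theorem writes_pendantGraph (h : IsLabelledGraph K c M label σ) (O : List Bool → List Bool) :
    Writes O (.relation (mul order₀ (order₀ + 3)) (pendantAdj M label)) σ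
      (graphCode ((pendantGraph K (fun v : Fin n => c v) (n + 2)).comap finProdFinEquiv.symm)) := by
  have hn : n ≤ σ.bound := by nlinarith [h.le_bound]
  have hwrites := Writes.relation (O := O) (m := mul order₀ (order₀ + 3))
    (e := pendantAdj M label) (σ := σ) (n := n * (n + 3))
    (fun v => by simp [eval_mul, h.order_eq, hn]) (by linarith [h.le_bound])
  simp only [h.holds_pendantAdj] at hwrites
  exact hwrites

end IsLabelledGraph

end Pendant

section StageLabelling

/-- The labels of the vertices of the first graph when the images of the first `k` of them under
an isomorphism have been found. -/
def stageLabel (k v : ℕ) : ℕ := if v < k then v + 1 else 0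

/-- The labels of the vertices of `H` are those of the vertices of `G`, carried over along an
isomorphism. -/
def IsStageLabelling {n : ℕ} (G H : SimpleGraph (Fin n)) (k : ℕ) (L : ℕ → ℕ) : Prop :=
  ∃ ψ : G ≃g H, ∀ v : Fin n, L (ψ v) = stageLabel k v

variable {n k : ℕ} {G H : SimpleGraph (Fin n)} {L : ℕ → ℕ}

theorem stageLabel_le (hk : k ≤ n) (v : ℕ) : stageLabel k v ≤ n := by
  unfold stageLabel
  split_ifs <;> omega

namespace IsStageLabelling

theorem zero (h : Nonempty (G ≃g H)) : IsStageLabelling G H 0 fun _ => 0 :=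
  h.elim fun ψ => ⟨ψ, fun _ => rfl⟩

theorem le (h : IsStageLabelling G H k L) (hk : k ≤ n) (w : Fin n) : L w ≤ n := by
  obtain ⟨ψ, hψ⟩ := h
  rw [← ψ.apply_symm_apply w, hψ]
  exact stageLabel_le hk _

theorem exists_succ (h : IsStageLabelling G H k L) (hk : k < n) :
    ∃ w < n, IsStageLabelling G H (k + 1) (Function.update L w (k + 1)) := by
  obtain ⟨ψ, hψ⟩ := h
  refine ⟨ψ ⟨k, hk⟩, Fin.is_lt _, ψ, fun v => ?_⟩
  obtain rfl | hv := eq_or_ne v ⟨k, hk⟩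
  · simp [stageLabel]
  · have hne : (ψ v : ℕ) ≠ ψ ⟨k, hk⟩ := Fin.val_ne_of_ne (ψ.injective.ne hv)
    have hvk : (v : ℕ) ≠ k := fun h => hv (Fin.ext h)
    rw [Function.update_of_ne hne, hψ, stageLabel, stageLabel]
    simp only [Nat.lt_succ_iff_lt_or_eq, hvk, or_false]

end IsStageLabelling

theorem nonempty_pendantGraph_iso_iff_isStageLabelling (hk : k ≤ n) (hL : ∀ w : Fin n, L w ≤ n) :
    Nonempty ((pendantGraph G (fun v => stageLabel k v + 2) (n + 2)).comap finProdFinEquiv.symm ≃g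
      (pendantGraph H (fun w => L w + 2) (n + 2)).comap finProdFinEquiv.symm) ↔
      IsStageLabelling G H k L := by
  have hiso := nonempty_pendantGraph_iso_iff (G := G) (H := H) (m := n + 2)
    (c := fun v => stageLabel k v + 2) (d := fun w => L w + 2) (by simp)
    (by simp [stageLabel_le hk]) (by simp) (by simpa)
  simp only [Nat.add_right_cancel_iff] at hiso
  rw [IsStageLabelling, ← hiso]
  let e := (finProdFinEquiv (m := n) (n := n + 3)).symm
  exact ⟨fun ⟨φ⟩ => ⟨((SimpleGraph.Iso.comap e _).symm.trans φ).trans (SimpleGraph.Iso.comap e _)⟩,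
    fun ⟨φ⟩ => ⟨((SimpleGraph.Iso.comap e _).trans φ).trans (SimpleGraph.Iso.comap e _).symm⟩⟩

end StageLabelling

/-- The entries of the permutation matrix of the conjugate of the given permutation by the
isomorphism that is recorded in the labels. -/
def Expr.conjugateEntry : Expr :=
  ex vertex order₀ <| ex vertex' order₀ <|
    ((eq (load .labels vertex) (row + 1)).and (eq (load .labels vertex') (column + 1))).and
      (entry .input matrix₂ order₀ vertex vertex')

namespace Cmd

/-- The program that writes the question whether the current candidate can be the image of the
current vertex. -/
def writeCandidate : Cmd :=
  seq (relation (mul order₀ (order₀ + 3))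
    (pendantAdj matrix₀ (.ite (lt vertex (stage + 1)) (vertex + 1) 0 + 2)))
  (relation (mul order₀ (order₀ + 3))
    (pendantAdj matrix₁ (.ite (eq vertex candidate) (stage + 1) (load .labels vertex) + 2)))

/-- The program that sets `found` to the current candidate if it can be the image of the current
vertex. -/
def tryCandidate : Cmd :=
  seq (seq writeCandidate ask) <| set found (.ite (eq (load .answer 0) 2) candidate found)

/-- The program that finds an image of the current vertex and labels it. -/
def findImage : Cmd :=
  seq (loop candidate order₀ tryCandidate) (store .labels found (stage + 1))

/-- The reduction of the reconstruction problem to graph isomorphism. -/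
def reconstruct : Cmd :=
  seq parse (seq (loop stage order₀ findImage) (matrix order₀ conjugateEntry))

end Cmd

section Reconstruct

variable {n k : ℕ} {G H : SimpleGraph (Fin n)} {w : List Bool} {O : List Bool → List Bool}
  {σ : Store}

theorem IsParsed.mul_add_le_bound (h : IsParsed G H w σ) : n * (n + 3) + 3 ≤ σ.bound := by
  nlinarith [h.le_bound, Nat.le_mul_self n]

theorem writes_candidate (hσ : IsParsed G H w σ) :
    Writes O .writeCandidate σ (
      graphCode ((pendantGraph G (fun v : Fin n => stageLabel (σ.reg stage + 1) v + 2)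
        (n + 2)).comap finProdFinEquiv.symm) ++
      graphCode ((pendantGraph H (fun v : Fin n => Function.update (σ.mem .labels)
        (σ.reg candidate) (σ.reg stage + 1) v + 2) (n + 2)).comap finProdFinEquiv.symm)) := by
  refine (IsLabelledGraph.writes_pendantGraph (c := fun v => stageLabel (σ.reg stage + 1) v + 2)
    ⟨.inl rfl, hσ.order₀, hσ.matrix₀, fun τ _ hstage _ => ?_, hσ.mul_add_le_bound⟩ O).seq
    (IsLabelledGraph.writes_pendantGraph (c := fun v => Function.update (σ.mem .labels)
      (σ.reg candidate) (σ.reg stage + 1) v + 2)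
    ⟨.inr rfl, hσ.order₀, hσ.matrix₁, fun τ hmem hstage hcandidate => ?_, hσ.mul_add_le_bound⟩ O)
  · simp [hstage, stageLabel]
  · simp [hmem, hstage, hcandidate, Function.update_apply]

open Classical in
theorem run_tryCandidate (hO : GI.SolvedBy O) (hσ : IsParsed G H w σ) (hbuf : σ.buf = [])
    (hk : σ.reg stage = k) (hkn : k < n) (hL : ∀ v : Fin n, σ.mem .labels v ≤ n) :
    ∃ f, Cmd.tryCandidate.run O σ = (σ.setArray .answer f).setReg found
      (if IsStageLabelling G H (k + 1)
        (Function.update (σ.mem .labels) (σ.reg candidate) (k + 1))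
      then σ.reg candidate else σ.reg found) := by
  subst hk
  have hL' (v : Fin n) :
      Function.update (σ.mem .labels) (σ.reg candidate) (σ.reg stage + 1) v ≤ n := by
    rw [Function.update_apply]
    split_ifs
    exacts [hkn, hL v]
  have hanswer := hO ⟨_, _, (pendantGraph G
      (fun v : Fin n => stageLabel (σ.reg stage + 1) v + 2) (n + 2)).comap finProdFinEquiv.symm,
    (pendantGraph H (fun v : Fin n => Function.update (σ.mem .labels)
      (σ.reg candidate) (σ.reg stage + 1) v + 2) (n + 2)).comap finProdFinEquiv.symm⟩
  simp only [GI, GIInstance.encode,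
    nonempty_pendantGraph_iso_iff_isStageLabelling hkn hL'] at hanswer
  refine ⟨cells [decide (IsStageLabelling G H (σ.reg stage + 1)
    (Function.update (σ.mem .labels) (σ.reg candidate) (σ.reg stage + 1)))], ?_⟩
  rw [Cmd.tryCandidate, Cmd.run, (writes_candidate hσ).run_seq_ask hbuf, hanswer]
  simp [Cmd.run, cells_eq_two_iff]

theorem exists_run_searchImage (hO : GI.SolvedBy O) (hσ : IsParsed G H w σ) (hbuf : σ.buf = [])
    (hk : σ.reg stage = k) (hkn : k < n) (hL : IsStageLabelling G H k (σ.mem .labels)) :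
    ∃ τ, (Cmd.loop candidate order₀ Cmd.tryCandidate).run O σ = τ ∧ IsParsed G H w τ ∧
      τ.buf = [] ∧ τ.reg stage = k ∧ τ.mem .labels = σ.mem .labels ∧
      IsStageLabelling G H (k + 1) (Function.update (σ.mem .labels) (τ.reg found) (k + 1)) := by
  let good v := IsStageLabelling G H (k + 1) (Function.update (σ.mem .labels) v (k + 1))
  have hn : min n σ.bound = n := min_eq_left (by nlinarith [hσ.le_bound])
  have hrun := loopRun_induction (r := candidate) (f := Cmd.tryCandidate.run O) (k := n) (σ := σ)
    (P := fun j τ => IsParsed G H w τ ∧ τ.buf = [] ∧ τ.reg stage = k ∧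
      τ.mem .labels = σ.mem .labels ∧ ((∃ v < j, good v) → good (τ.reg found)))
    (fun j τ x ⟨h, h'⟩ => ⟨h.setReg (by decide) x, h'⟩)
    ⟨hσ, hbuf, hk, rfl, by simp⟩ fun j _ τ ⟨hτ, hτbuf, hτk, hτL, hfound⟩ => by
      obtain ⟨f, hf⟩ := run_tryCandidate (σ := τ.setReg candidate j) hO
        (hτ.setReg (by decide) j) hτbuf hτk hkn (by rw [mem_setReg, hτL]; exact hL.le hkn.le)
      rw [hf]
      refine ⟨.setReg (.setArray (hτ.setReg (by decide) j) (by decide) f) (by decide) _,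
        hτbuf, hτk, hτL, fun ⟨v, hvj, hv⟩ => ?_⟩
      have hcandidate : (τ.setReg candidate j).reg candidate = j := by rw [reg_setReg, if_pos rfl]
      rw [reg_setReg, if_pos rfl, hcandidate, mem_setReg, hτL]
      split_ifs with hj
      · exact hj
      · obtain hvj | rfl := Nat.lt_succ_iff_lt_or_eq.1 hvj
        exacts [hfound ⟨v, hvj, hv⟩, absurd hv hj]
  obtain ⟨hτ, hτbuf, hτk, hτL, hfound⟩ := hrun
  refine ⟨_, by rw [Cmd.run, eval_var, hσ.order₀, hn], hτ, hτbuf, hτk, hτL, ?_⟩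
  exact hfound (hL.exists_succ hkn)

/-- The store before the image of the vertex `k` of `G` is searched for. -/
structure IsStage (G H : SimpleGraph (Fin n)) (w : List Bool) (k : ℕ) (σ : Store) : Prop where
  isParsed : IsParsed G H w σ
  buf_eq : σ.buf = []
  isStageLabelling : IsStageLabelling G H k (σ.mem .labels)

namespace IsStage

theorem setReg (hσ : IsStage G H w k σ) {r : Reg} (hr : r ∉ layout) (v : ℕ) :
    IsStage G H w k (σ.setReg r v) :=
  ⟨hσ.isParsed.setReg hr v, hσ.buf_eq, hσ.isStageLabelling⟩

theorem findImage (hO : GI.SolvedBy O) (hσ : IsStage G H w k σ) (hk : σ.reg stage = k)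
    (hkn : k < n) : IsStage G H w (k + 1) (Cmd.findImage.run O σ) := by
  obtain ⟨τ, hτ, hparsed, hbuf, hstage, hlabels, hgood⟩ :=
    exists_run_searchImage hO hσ.isParsed hσ.buf_eq hk hkn hσ.isStageLabelling
  rw [Cmd.findImage, Cmd.run, hτ]
  refine ⟨hparsed.setArray (by decide) _, hbuf, ?_⟩
  simpa [Cmd.run, hstage, hlabels] using hgood

theorem findImages (hO : GI.SolvedBy O) (hσ : IsStage G H w 0 σ) :
    IsStage G H w n ((Cmd.loop stage order₀ Cmd.findImage).run O σ) := by
  have hn : min n σ.bound = n := min_eq_left (by nlinarith [hσ.isParsed.le_bound])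
  rw [Cmd.run, eval_var, hσ.isParsed.order₀, hn]
  exact loopRun_induction (P := IsStage G H w) (fun _ _ x h => h.setReg (by decide) x) hσ
    fun v hv τ h => (h.setReg (by decide) v).findImage hO (by simp) hv

theorem exists_writes_conjugate {β : Equiv.Perm (Fin n)} (hσ : IsStage G H (permCode β) n σ) :
    ∃ ψ : G ≃g H, Writes O (.matrix order₀ conjugateEntry) σ
      (permCode (ψ.toEquiv.symm.permCongr β)) := by
  obtain ⟨⟨hn, -, -, -, hβ, hbound⟩, -, ψ, hψ⟩ := hσ
  have hbound : n ≤ σ.bound := by nlinarith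
  have hlabel (u a : Fin n) : σ.mem .labels u = a + 1 ↔ u = ψ a := by
    rw [← ψ.apply_symm_apply u, hψ, stageLabel, if_pos (Fin.is_lt _), Nat.add_right_cancel_iff,
      Fin.val_inj, EmbeddingLike.apply_eq_iff_eq]
  have hentry (u v : Fin n) : σ.mem .input (σ.reg matrix₂ + (v + n * u)) = 2 ↔ β u = v := by
    rw [hβ, ← cells_matrixBits_append (fun u v => β u = v) []]
    simp only [permCode, List.append_nil]
  have hholds (i j : Fin n) : conjugateEntry.Holds ((σ.setReg row i).setReg column j) ↔
      ψ.toEquiv.symm.permCongr β i = j := by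
    rw [conjugateEntry, holds_ex (k := n) (by simp [hn]) (by simpa)]
    trans ∃ u v, (u = ψ i ∧ v = ψ j) ∧ β u = v
    · refine exists_congr fun u => ?_
      rw [holds_ex (k := n) (by simp [hn]) (by simpa)]
      simp [holds_entry, hn, hbound, hlabel, hentry]
    · simp [Equiv.symm_apply_eq]
  refine ⟨ψ, ?_⟩
  simpa only [hholds, permCode] using Writes.matrix (O := O) (e := conjugateEntry)
    (fun v => by simp [hn]) hbound

end IsStage

end Reconstruct

theorem par_reducible_gi : PolyTimeTuringReducible PAR GI := by
  refine polyTimeTuringReducible_of_run .reconstruct fun O hO ⟨n, G, H, β, hiso, hβ⟩ => ?_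
  let σ := Cmd.parse.run O (initStore (PAR.encode ⟨n, G, H, β, hiso, hβ⟩)
    ((PAR.encode ⟨n, G, H, β, hiso, hβ⟩).length + 2))
  have hσ : IsStage G H (permCode β) 0 σ := ⟨isParsed_parse rfl le_rfl, rfl, .zero hiso⟩
  have hτ := hσ.findImages hO
  obtain ⟨ψ, hψ⟩ := hτ.exists_writes_conjugate (O := O)
  refine ⟨_, hβ.conj ψ, ?_⟩
  rw [Cmd.reconstruct, Cmd.run, Cmd.run, hψ.run_eq]
  simp [Store.append, hτ.buf_eq]

/-! ### From isomorphism to automorphism reconstruction -/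

section DoubledGraphFin

variable {n : ℕ} {X Y : SimpleGraph (Fin n)}

/-- The numbering of the vertices of a double cone in which the two apices come last. -/
def doubleConeEquiv (n : ℕ) : Option (Option (Fin n)) ≃ Fin (n + 2) :=
  (Equiv.optionCongr finSuccEquivLast.symm).trans finSuccEquivLast.symm

/-- The numbering of the vertices of a doubled graph, one half after the other. -/
def doubledEquiv (n : ℕ) :
    Option (Option (Fin n)) ⊕ Option (Option (Fin n)) ≃ Fin (n + 2 + (n + 2)) :=
  (Equiv.sumCongr (doubleConeEquiv n) (doubleConeEquiv n)).trans finSumFinEquiv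

/-- The doubled graph of two graphs on numbered vertices, on numbered vertices. -/
def doubledGraphFin (X Y : SimpleGraph (Fin n)) : SimpleGraph (Fin (n + 2 + (n + 2))) :=
  (doubledGraph X Y).comap (doubledEquiv n).symm

/-- The numbering of the vertices as an isomorphism. -/
def doubledGraphFinIso (X Y : SimpleGraph (Fin n)) : doubledGraphFin X Y ≃g doubledGraph X Y :=
  SimpleGraph.Iso.comap (doubledEquiv n).symm _

@[simp]
theorem doubleConeEquiv_none : (doubleConeEquiv n none : ℕ) = n + 1 := by
  simp [doubleConeEquiv, Equiv.optionCongr]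

@[simp]
theorem doubleConeEquiv_some_none : (doubleConeEquiv n (some none) : ℕ) = n := by
  simp [doubleConeEquiv, Equiv.optionCongr]

@[simp]
theorem doubleConeEquiv_some_some (v : Fin n) : (doubleConeEquiv n (some (some v)) : ℕ) = v := by
  simp [doubleConeEquiv, Equiv.optionCongr]

@[simp]
theorem doubledEquiv_inl (a : Option (Option (Fin n))) :
    (doubledEquiv n (.inl a) : ℕ) = doubleConeEquiv n a := rfl

@[simp]
theorem doubledEquiv_inr (a : Option (Option (Fin n))) :
    (doubledEquiv n (.inr a) : ℕ) = n + 2 + doubleConeEquiv n a := rfl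

theorem cone_cone_adj_iff {R : ℕ → ℕ → Prop} (hR : ∀ u v : Fin n, R u v ↔ X.Adj u v)
    (a b : Option (Option (Fin n))) :
    (cone (cone X)).Adj a b ↔ (doubleConeEquiv n a : ℕ) ≠ doubleConeEquiv n b ∧
      (n ≤ doubleConeEquiv n a ∨ n ≤ doubleConeEquiv n b ∨
        R (doubleConeEquiv n a) (doubleConeEquiv n b)) := by
  have ne_apex (v : Fin n) : (v : ℕ) ≠ n + 1 := by omega
  obtain _ | _ | u := a <;> obtain _ | _ | v := b <;>
    simp +contextual [hR, not_le.2, Fin.val_inj, (Fin.is_lt _).ne, (Fin.is_lt _).ne', ne_apex,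
      (ne_apex _).symm, X.ne_of_adj]

theorem doubledGraphFin_adj_iff {R S : ℕ → ℕ → Prop} (hR : ∀ u v : Fin n, R u v ↔ X.Adj u v)
    (hS : ∀ u v : Fin n, S u v ↔ Y.Adj u v) (i j : Fin (n + 2 + (n + 2))) :
    (doubledGraphFin X Y).Adj i j ↔ (i : ℕ) ≠ j ∧
      ((i < n + 2 ∧ j < n + 2) ∧ (n ≤ i ∨ n ≤ j ∨ R i j) ∨
      (n + 2 ≤ i ∧ n + 2 ≤ j) ∧
        (n ≤ i - (n + 2) ∨ n ≤ j - (n + 2) ∨ S (i - (n + 2)) (j - (n + 2)))) := by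
  obtain ⟨a, rfl⟩ := (doubledEquiv n).surjective i
  obtain ⟨b, rfl⟩ := (doubledEquiv n).surjective j
  rw [doubledGraphFin, SimpleGraph.comap_adj, Equiv.symm_apply_apply, Equiv.symm_apply_apply]
  obtain a | a := a <;> obtain b | b := b
  · rw [doubledGraph, SimpleGraph.sum_adj_inl, cone_cone_adj_iff hR]
    simp
  · simp [doubledGraph]
  · simp [doubledGraph]
  · rw [doubledGraph, SimpleGraph.sum_adj_inr, cone_cone_adj_iff hS]
    simp

/-- The exchange of the two halves of a doubled graph. -/
def exchange (n : ℕ) : Equiv.Perm (Fin (n + 2 + (n + 2))) :=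
  (doubledEquiv n).permCongr (Equiv.sumComm _ _)

theorem exchange_apply_eq_iff (i j : Fin (n + 2 + (n + 2))) :
    exchange n i = j ↔ (j : ℕ) = i + (n + 2) ∨ (i : ℕ) = j + (n + 2) := by
  obtain ⟨a, rfl⟩ := (doubledEquiv n).surjective i
  rw [exchange, Equiv.permCongr_apply, Equiv.symm_apply_apply, Fin.ext_iff]
  obtain a | a := a
  · simp only [Equiv.sumComm_apply, Sum.swap_inl, doubledEquiv_inl, doubledEquiv_inr]
    omega
  · simp only [Equiv.sumComm_apply, Sum.swap_inr, doubledEquiv_inl, doubledEquiv_inr]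
    omega

theorem isFixedEdgeFreeInvolution_exchange (X : SimpleGraph (Fin n)) :
    IsFixedEdgeFreeInvolution (doubledGraphFin X X) (exchange n) := by
  refine isFixedEdgeFreeInvolution_iff.2 ⟨fun h => ?_,
    (isEdgeDisplacing_sum_swap _).conj (doubledGraphFinIso X X)⟩
  simpa [exchange] using DFunLike.congr_fun h (doubledEquiv n (.inl none))

/-- The instance of the reconstruction problem whose solutions show that `X` and `Y` are
isomorphic. -/
def doubledInstance (h : Nonempty (X ≃g Y)) : PARInstance where
  n := n + 2 + (n + 2)
  G := doubledGraphFin X Y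
  H := doubledGraphFin X X
  β := exchange n
  iso := h.map fun φ => ((doubledGraphFinIso X Y).trans (doubledGraphCongrRight φ.symm)).trans
    (doubledGraphFinIso X X).symm
  involution := isFixedEdgeFreeInvolution_exchange X

theorem exists_isEdgeDisplacing_doubledGraphFin_iff :
    (∃ f, IsEdgeDisplacing (doubledGraphFin X Y) f) ↔ Nonempty (X ≃g Y) := by
  rw [← exists_isEdgeDisplacing_doubledGraph_iff rfl]
  exact ⟨fun ⟨_, hf⟩ => ⟨_, hf.conj (doubledGraphFinIso X Y).symm⟩,
    fun ⟨_, hf⟩ => ⟨_, hf.conj (doubledGraphFinIso X Y)⟩⟩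

end DoubledGraphFin

/-- The relation `R` is the graph of an edge-displacing involution of `G`. -/
def IsEdgeDisplacingRel {V : Type*} (G : SimpleGraph V) (R : V → V → Prop) : Prop :=
  ∀ u, (∃ u', R u u') ∧ ∀ u', R u u' → R u' u ∧ ∀ v v', R v v' →
    (u = v → u' = v') ∧ (G.Adj u' v' ↔ G.Adj u v) ∧
      (G.Adj u v → ¬(u' = u ∧ v' = v ∨ u' = v ∧ v' = u))

theorem isEdgeDisplacingRel_iff {V : Type*} {G : SimpleGraph V} {R : V → V → Prop} :
    IsEdgeDisplacingRel G R ↔ ∃ f, IsEdgeDisplacing G f ∧ ∀ u v, R u v ↔ f u = v := by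
  constructor
  · intro h
    choose f hf using fun u => (h u).1
    refine ⟨f, ⟨fun u => ?_, fun u v => ?_, fun {u v} huv => ?_⟩, fun u v => ⟨fun huv => ?_, ?_⟩⟩
    · exact (((h (f u)).2 _ (hf (f u))).2 _ _ ((h u).2 _ (hf u)).1).1 rfl
    · exact (((h u).2 _ (hf u)).2 _ _ (hf v)).2.1
    · rw [Ne, Sym2.eq_iff]
      exact (((h u).2 _ (hf u)).2 _ _ (hf v)).2.2 huv
    · exact (((h u).2 _ (hf u)).2 _ _ huv).1 rfl
    · rintro rfl
      exact hf u
  · rintro ⟨f, hf, hR⟩ u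
    simp only [hR]
    refine ⟨⟨_, rfl⟩, ?_⟩
    rintro _ rfl
    refine ⟨hf.involutive u, ?_⟩
    rintro v _ rfl
    refine ⟨congrArg f, hf.adj_iff u v, fun huv => ?_⟩
    rw [← Sym2.eq_iff]
    exact hf.map_edge_ne huv

theorem isEdgeDisplacingRel_answer_iff {O : List Bool → List Bool} (hO : PAR.SolvedBy O) {n : ℕ}
    {X Y : SimpleGraph (Fin n)} :
    (IsEdgeDisplacingRel (doubledGraphFin X Y) fun i j =>
      cells (O (graphCode (doubledGraphFin X Y) ++
        (graphCode (doubledGraphFin X X) ++ permCode (exchange n))))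
          (j + (n + 2 + (n + 2)) * i) = 2) ↔ Nonempty (X ≃g Y) := by
  rw [isEdgeDisplacingRel_iff]
  constructor
  · rintro ⟨f, hf, -⟩
    exact exists_isEdgeDisplacing_doubledGraphFin_iff.1 ⟨f, hf⟩
  · intro h
    obtain ⟨α, hα, hy⟩ := hO (doubledInstance h)
    refine ⟨α, (isFixedEdgeFreeInvolution_iff.1 hα).2, fun i j => ?_⟩
    have hcells := cells_matrixBits_append (fun i j => α i = j) [] i j
    rwa [List.append_nil, ← permCode, ← hy] at hcells

namespace Expr

/-- The adjacency in the double cone over the graph of order `order₀` whose matrix starts at `M`,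
apart from the condition that the vertices differ. -/
def doubleConeAdj (M : Reg) (a b : Expr) : Expr :=
  ((le order₀ a).or (le order₀ b)).or (entry .input M order₀ a b)

/-- The adjacency between the vertices in the registers `a` and `b` of the doubled graph of the two
graphs of order `order₀` whose matrices start at `M` and `M'`. -/
def doubledAdj (M M' a b : Reg) : Expr :=
  (eq a b).not.and <|
    (((lt a (order₀ + 2)).and (lt b (order₀ + 2))).and (doubleConeAdj M a b)).or
      (((le (order₀ + 2) a).and (le (order₀ + 2) b)).and
        (doubleConeAdj M' (a - (order₀ + 2)) (b - (order₀ + 2))))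

/-- The order of a doubled graph of two graphs of order `order₀`. -/
def doubledOrder : Expr := order₀ + 2 + (order₀ + 2)

/-- The entry in row `a` and column `b` of the last answer of the oracle. -/
def answerEntry (a b : Reg) : Expr := entry .answer 0 doubledOrder a b

/-- The condition `IsEdgeDisplacingRel` for the last answer of the oracle, read as the matrix of a
relation on the doubled graph of the two input graphs. -/
def checkAnswer : Expr :=
  all row doubledOrder <| (ex column doubledOrder (answerEntry row column)).and <|
    all column doubledOrder <| (answerEntry row column).implies <| (answerEntry column row).and <|
      all vertex doubledOrder <| all vertex' doubledOrder <|
        (answerEntry vertex vertex').implies <|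
          ((eq row vertex).implies (eq column vertex')).and <|
            (((doubledAdj matrix₀ matrix₁ column vertex').implies
                (doubledAdj matrix₀ matrix₁ row vertex)).and
              ((doubledAdj matrix₀ matrix₁ row vertex).implies
                (doubledAdj matrix₀ matrix₁ column vertex'))).and <|
              (doubledAdj matrix₀ matrix₁ row vertex).implies <|
                (((eq column row).and (eq vertex' vertex)).or
                  ((eq column vertex).and (eq vertex' row))).not

end Expr

namespace Cmd

/-- The program that writes the instance of the reconstruction problem for the two input graphs,
which is well formed only if they are isomorphic. -/
def writeDoubledInstance : Cmd :=
  seq (relation doubledOrder (doubledAdj matrix₀ matrix₁ row column)) <|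
  seq (relation doubledOrder (doubledAdj matrix₀ matrix₀ row column)) <|
  matrix doubledOrder ((eq column (row + (order₀ + 2))).or (eq row (column + (order₀ + 2))))

/-- The reduction of graph isomorphism to the reconstruction problem. The oracle's answer has to be
checked, as it is arbitrary if the graphs are not isomorphic. -/
def decideIso : Cmd :=
  seq parse (seq (seq writeDoubledInstance ask) (push ((eq order₀ order₁).and checkAnswer)))

end Cmd

section DecideIso

variable {n m : ℕ} {X Y : SimpleGraph (Fin n)} {σ : Store} {O : List Bool → List Bool}

theorem eval_doubledOrder (hn : σ.reg order₀ = n) : doubledOrder.eval σ = n + 2 + (n + 2) := by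
  simp [doubledOrder, hn]

theorem exists_writes_doubledInstance (hn : σ.reg order₀ = n)
    (hbound : n + 2 + (n + 2) ≤ σ.bound) : ∃ w, Writes O .writeDoubledInstance σ w := by
  have horder v : doubledOrder.eval (σ.setReg row v) = n + 2 + (n + 2) := eval_doubledOrder hn
  exact ⟨_, (Writes.relation horder hbound).seq <| (Writes.relation horder hbound).seq <|
    Writes.matrix horder hbound⟩

variable {w : List Bool}

theorem IsParsed.doubledOrder_le_bound {H : SimpleGraph (Fin m)} (h : IsParsed X H w σ) :
    n + 2 + (n + 2) ≤ σ.bound := by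
  nlinarith [h.le_bound, Nat.le_mul_self n]

theorem holds_doubledAdj (hσ : IsParsed X Y w σ) {Z : SimpleGraph (Fin n)} {M a b : Reg}
    (hM : ∀ i j : Fin n, σ.mem .input (σ.reg M + (j + n * i)) = 2 ↔ Z.Adj i j) (ha : a ≠ factor)
    {i j : Fin (n + 2 + (n + 2))} (hi : σ.reg a = i) (hj : σ.reg b = j) :
    (doubledAdj matrix₀ M a b).Holds σ ↔ (doubledGraphFin X Z).Adj i j := by
  have hn : n ≤ σ.bound := by linarith [hσ.doubledOrder_le_bound]
  rw [doubledGraphFin_adj_iff (R := fun i j => σ.mem .input (σ.reg matrix₀ + (j + n * i)) = 2)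
    (S := fun i j => σ.mem .input (σ.reg M + (j + n * i)) = 2) hσ.matrix₀ hM]
  simp [doubledAdj, doubleConeAdj, holds_entry, hσ.order₀, hn, hi, hj, ha, or_assoc]

theorem writes_doubledInstance (hσ : IsParsed X Y w σ) :
    Writes O .writeDoubledInstance σ (graphCode (doubledGraphFin X Y) ++
      (graphCode (doubledGraphFin X X) ++ permCode (exchange n))) := by
  have hbound := hσ.doubledOrder_le_bound
  have horder v : doubledOrder.eval (σ.setReg row v) = n + 2 + (n + 2) :=
    eval_doubledOrder hσ.order₀
  have hτ (i j : Fin (n + 2 + (n + 2))) : IsParsed X Y w ((σ.setReg row i).setReg column j) :=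
    (hσ.setReg (by decide) i).setReg (by decide) j
  have hfirst (i j : Fin (n + 2 + (n + 2))) :
      (doubledAdj matrix₀ matrix₁ row column).Holds ((σ.setReg row i).setReg column j) ↔
        (doubledGraphFin X Y).Adj i j :=
    holds_doubledAdj (hτ i j) (hτ i j).matrix₁ (by decide) (by simp) (by simp)
  have hsecond (i j : Fin (n + 2 + (n + 2))) :
      (doubledAdj matrix₀ matrix₀ row column).Holds ((σ.setReg row i).setReg column j) ↔
        (doubledGraphFin X X).Adj i j :=
    holds_doubledAdj (hτ i j) (hτ i j).matrix₀ (by decide) (by simp) (by simp)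
  have hthird (i j : Fin (n + 2 + (n + 2))) :
      ((eq column (row + (order₀ + 2))).or (eq row (column + (order₀ + 2)))).Holds
        ((σ.setReg row i).setReg column j) ↔ exchange n i = j := by
    simp [exchange_apply_eq_iff, hσ.order₀]
  have hwrites : Writes O .writeDoubledInstance σ _ := (Writes.relation horder hbound).seq <|
    (Writes.relation horder hbound).seq <| Writes.matrix horder hbound
  simp only [hfirst, hsecond, hthird] at hwrites
  exact hwrites

theorem holds_ex_doubledOrder (hσ : IsParsed X Y w σ) {r : Reg} {e : Expr} :
    (ex r doubledOrder e).Holds σ ↔ ∃ v : Fin (n + 2 + (n + 2)), e.Holds (σ.setReg r v) :=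
  holds_ex (eval_doubledOrder hσ.order₀) hσ.doubledOrder_le_bound

theorem holds_all_doubledOrder (hσ : IsParsed X Y w σ) {r : Reg} {e : Expr} :
    (all r doubledOrder e).Holds σ ↔ ∀ v : Fin (n + 2 + (n + 2)), e.Holds (σ.setReg r v) :=
  holds_all (eval_doubledOrder hσ.order₀) hσ.doubledOrder_le_bound

theorem holds_answerEntry (hσ : IsParsed X Y w σ) {a b : Reg} (ha : a ≠ factor) :
    (answerEntry a b).Holds σ ↔ σ.mem .answer (σ.reg b + (n + 2 + (n + 2)) * σ.reg a) = 2 := by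
  rw [answerEntry, holds_entry] <;>
    simp [eval_doubledOrder hσ.order₀, hσ.doubledOrder_le_bound, ha]

theorem holds_checkAnswer (hσ : IsParsed X Y w σ) : checkAnswer.Holds σ ↔
    IsEdgeDisplacingRel (doubledGraphFin X Y) fun i j =>
      σ.mem .answer (j + (n + 2 + (n + 2)) * i) = 2 := by
  rw [checkAnswer, holds_all_doubledOrder hσ]
  refine forall_congr' fun u => ?_
  have hu := hσ.setReg (r := row) (by decide) u
  have huu' (u' : ℕ) := hu.setReg (r := column) (by decide) u'
  rw [holds_and, holds_ex_doubledOrder hu, holds_all_doubledOrder hu]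
  refine and_congr (exists_congr fun u' => ?_) (forall_congr' fun u' => ?_)
  · rw [holds_answerEntry (huu' u') (by decide)]
    simp
  rw [holds_implies, holds_and, holds_answerEntry (huu' u') (by decide),
    holds_answerEntry (huu' u') (by decide), holds_all_doubledOrder (huu' u')]
  refine imp_congr (by simp) (and_congr (by simp) (forall_congr' fun v => ?_))
  have hv := (huu' u').setReg (r := vertex) (by decide) v
  rw [holds_all_doubledOrder hv]
  refine forall_congr' fun v' => ?_
  have hv' := hv.setReg (r := vertex') (by decide) v'
  have hadj_uv := holds_doubledAdj hv' hv'.matrix₁ (a := row) (b := vertex) (i := u) (j := v)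
    (by decide) (by simp) (by simp)
  have hadj_uv' := holds_doubledAdj hv' hv'.matrix₁ (a := column) (b := vertex') (i := u')
    (j := v') (by decide) (by simp) (by simp)
  simp only [holds_implies, holds_and, holds_or, holds_not, hadj_uv, hadj_uv',
    holds_answerEntry hv' (a := vertex) (b := vertex') (by decide)]
  simp [Fin.val_inj, iff_iff_implies_and_implies]

open Classical in
theorem run_decideIso (hO : PAR.SolvedBy O) {Y : SimpleGraph (Fin m)} (hσ : IsParsed X Y w σ)
    (hbuf : σ.buf = []) :
    (Cmd.run O (.seq (.seq .writeDoubledInstance .ask)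
      (.push ((eq order₀ order₁).and checkAnswer))) σ).buf = [decide (Nonempty (X ≃g Y))] := by
  obtain rfl | hnm := eq_or_ne n m
  · have hτ := hσ.setArray (A := .answer) (by decide) (cells (O (graphCode (doubledGraphFin X Y) ++
      (graphCode (doubledGraphFin X X) ++ permCode (exchange n)))))
    have hcheck := (holds_checkAnswer hτ).trans (by
      simpa using isEdgeDisplacingRel_answer_iff hO (X := X) (Y := Y))
    rw [Cmd.run, (writes_doubledInstance hσ).run_seq_ask hbuf, Cmd.run_push]
    simp [Store.append, hbuf, hσ.order₀, hσ.order₁, hcheck]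
  · have hXY : ¬Nonempty (X ≃g Y) := fun ⟨φ⟩ => hnm (Fin.equiv_iff_eq.1 ⟨φ.toEquiv⟩)
    obtain ⟨u, hu⟩ := exists_writes_doubledInstance (O := O) hσ.order₀ hσ.doubledOrder_le_bound
    rw [Cmd.run, hu.run_seq_ask hbuf, Cmd.run_push]
    simp [Store.append, hbuf, hσ.order₀, hσ.order₁, hnm, hXY]

end DecideIso

theorem gi_reducible_par : PolyTimeTuringReducible GI PAR := by
  refine polyTimeTuringReducible_of_run .decideIso fun O hO ⟨n, m, X, Y⟩ => ?_
  have hcode : GI.encode ⟨n, m, X, Y⟩ = graphCode X ++ (graphCode Y ++ []) := by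
    rw [List.append_nil]
    rfl
  exact run_decideIso hO (isParsed_parse (congrArg cells hcode) (by rw [hcode]; exact le_rfl)) rfl

end LoopProgram

theorem mainTheorem7 : PolyTimeEquivalent PAR GI :=
  ⟨LoopProgram.par_reducible_gi, LoopProgram.gi_reducible_par⟩
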